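/- Let $k\ge 1$ be an integer, let $\lambda_1,\dots,\lambda_k,\mu_1,\dots,\mu_k>0$ and $0<\alpha\le 1$. Let $M_1,M_2$ be independent generalized counting processes with rates $(\lambda_j)$ and $(\mu_j)$, that is, $\mathbb{N}_0$-valued Lévy processes such that, for $M_1$, as $h\downarrow 0$, $\Pr\{M_1(t+h)=n\mid M_1(t)=m\}$ equals $1-(\lambda_1+\dots+\lambda_k)h+o(h)$ for $n=m$, $\lambda_jh+o(h)$ for $n=m+j$, $1\le j\le k$, and $o(h)$ for $n>m+k$, and likewise for $M_2$ with the $\mu_j$. Put $\mathcal S(t)=M_1(t)-M_2(t)$. For $\alpha<1$ let $Y_\alpha(t)=\inf\{x\ge 0: D_\alpha(x)>t\}$ be the inverse of an $\alpha$-stable subordinator $D_\alpha$ (a non-decreasing Lévy process with $\mathbb{E}\,e^{-sD_\alpha(t)}=e^{-ts^\alpha}$ for $s>0$), with $Y_\alpha$ independent of $\mathcal S$, and put $\mathcal S^\alpha(t)=\mathcal S(Y_\alpha(t))$; for $\alpha=1$ put $\mathcal S^1(t)=\mathcal S(t)$. Let $D_f$ be a Lévy subordinator, independent of $\mathcal S^\alpha$,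 with $\mathbb{E}\big(D_f^r(t)\big)<\infty$ for all $r>0$ and $t\ge 0$. The time-changed generalized fractional Skellam process-I (TCGFSP-I) is $$\mathcal Z_f^\alpha(t)=\mathcal S^\alpha(D_f(t)),\qquad t\ge 0.$$ **Theorem (LRD property of TCGFSP-I).** Suppose that, as $t\to\infty$, $$\mathbb{E}\big(D_f^{i\alpha}(t)\big)\sim k_i\,t^{i\rho},\qquad i=1,2,$$ for some $0<\rho<1$, $k_1>0$ and $k_2\ge k_1^2$. Then $\{\mathcal Z_f^\alpha(t)\}_{t\ge0}$ has the long-range dependence property: it is a non-stationary process with finite second moments and there is $\gamma\in(0,1)$ such that for every fixed $s>0$ there is $c(s)>0$ with $$\operatorname{Corr}\big(\mathcal Z_f^\alpha(s),\mathcal Z_f^\alpha(t)\big)\sim c(s)\,t^{-\gamma}\qquad\text{as } t\to\infty.$$ Moreover, if $\sum_{j=1}^k j(\lambda_j-\mu_j)\neq 0$, then this holds with $\gamma=\rho$. -/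

import Mathlib

open MeasureTheory ProbabilityTheory Filter Topology Asymptotics
open scoped NNReal

namespace Skellam

noncomputable section

/-- A one-dimensional Lévy process on the time set `[0, ∞)`: it starts at `0` almost surely, has
independent and stationary increments, and almost all of its paths are right-continuous with left
limits. -/
structure IsLevyProcess {Ω : Type*} [MeasurableSpace Ω] (X : ℝ≥0 → Ω → ℝ) (P : Measure Ω) :
    Prop where
  measurable : ∀ t, Measurable (X t)
  zero : ∀ᵐ ω ∂P, X 0 ω = 0
  indep : HasIndepIncrements X P
  stationary : ∀ s h, IdentDistrib (fun ω => X (s + h) ω - X s ω) (X h) P P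
  cadlag : ∀ᵐ ω ∂P, ∀ t : ℝ≥0, ContinuousWithinAt (fun u => X u ω) (Set.Ici t) t ∧
    ∃ l : ℝ, Tendsto (fun u => X u ω) (𝓝[<] t) (𝓝 l)

/-- A subordinator: a Lévy process whose paths are almost surely non-decreasing. Its values are
taken in `[0, ∞)`, so that it can serve as a random time. -/
structure IsSubordinator {Ω : Type*} [MeasurableSpace Ω] (D : ℝ≥0 → Ω → ℝ≥0) (P : Measure Ω) :
    Prop where
  levy : IsLevyProcess (fun t ω => (D t ω : ℝ)) P
  monotone : ∀ᵐ ω ∂P, Monotone (fun t => D t ω)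

/-- The `α`-stable subordinator: the subordinator with Bernstein function `f(s) = s ^ α`, that is,
`E(exp(-s D(t))) = exp(-t s ^ α)`. For `α = 1` it is the pure drift `D(t) = t`. -/
structure IsStableSubordinator {Ω : Type*} [MeasurableSpace Ω] (α : ℝ) (D : ℝ≥0 → Ω → ℝ≥0)
    (P : Measure Ω) : Prop where
  subordinator : IsSubordinator D P
  laplace : ∀ (t : ℝ≥0) (s : ℝ), 0 < s →
    ∫ ω, Real.exp (-s * (D t ω : ℝ)) ∂P = Real.exp (-(t : ℝ) * s ^ α)

/-- The first passage time `inf {x ≥ 0 : D(x) > t}` of a process `D`; for a stable subordinator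
this is the inverse stable subordinator (the set is then almost surely non-empty). -/
def firstPassage {Ω : Type*} (D : ℝ≥0 → Ω → ℝ≥0) (t : ℝ≥0) (ω : Ω) : ℝ≥0 :=
  sInf {x : ℝ≥0 | t < D x ω}

/-- The generalized counting process with jumps of amplitude `1, …, k` at rates
`rate 1, …, rate k`: a Lévy process with values in `ℕ` and the transition probabilities
`Pr{M(t+h) = n | M(t) = m}` equal to `1 - Λ h + o(h)` for `n = m`, to `rate j * h + o(h)` for
`n = m + j`, `1 ≤ j ≤ k`, and to `o(h)` for `n > m + k`, where `Λ = rate 1 + ⋯ + rate k`. -/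
structure IsGeneralizedCountingProcess {Ω : Type*} [MeasurableSpace Ω] (k : ℕ) (rate : ℕ → ℝ)
    (M : ℝ≥0 → Ω → ℕ) (P : Measure Ω) : Prop where
  levy : IsLevyProcess (fun t ω => (M t ω : ℝ)) P
  stay : ∀ (t : ℝ≥0) (m : ℕ), P (M t ⁻¹' {m}) ≠ 0 →
    (fun h : ℝ≥0 => (ProbabilityTheory.cond P (M t ⁻¹' {m})).real (M (t + h) ⁻¹' {m})
      - (1 - (∑ j ∈ Finset.Icc 1 k, rate j) * (h : ℝ))) =o[𝓝[>] 0] (fun h : ℝ≥0 => (h : ℝ))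
  jump : ∀ (t : ℝ≥0) (m : ℕ), P (M t ⁻¹' {m}) ≠ 0 → ∀ j ∈ Finset.Icc 1 k,
    (fun h : ℝ≥0 => (ProbabilityTheory.cond P (M t ⁻¹' {m})).real (M (t + h) ⁻¹' {m + j})
      - rate j * (h : ℝ)) =o[𝓝[>] 0] (fun h : ℝ≥0 => (h : ℝ))
  far : ∀ (t : ℝ≥0) (m : ℕ), P (M t ⁻¹' {m}) ≠ 0 → ∀ n : ℕ, m + k < n →
    (fun h : ℝ≥0 => (ProbabilityTheory.cond P (M t ⁻¹' {m})).real (M (t + h) ⁻¹' {n}))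
      =o[𝓝[>] 0] (fun h : ℝ≥0 => (h : ℝ))

/-- The generalized Skellam process `S(t) = M₁(t) - M₂(t)`. -/
def gsp {Ω : Type*} (M₁ M₂ : ℝ≥0 → Ω → ℕ) (t : ℝ≥0) (ω : Ω) : ℤ :=
  (M₁ t ω : ℤ) - (M₂ t ω : ℤ)

/-- The generalized fractional Skellam process: `S(Y(t))` for `α < 1` and `S(t)` for `α = 1`, where
`Y` is the inverse stable subordinator. -/
def gfsp {Ω : Type*} (α : ℝ) (S : ℝ≥0 → Ω → ℤ) (Y : ℝ≥0 → Ω → ℝ≥0) (t : ℝ≥0) (ω : Ω) : ℤ :=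
  open Classical in if α < 1 then S (Y t ω) ω else S t ω

/-- The time-changed generalized fractional Skellam process-I, `t ↦ S^α(D(t))`: the generalized
fractional Skellam process at the random times given by `D`. Here `L` is the stable subordinator
whose inverse enters the generalized fractional Skellam process. -/
def tcgfspI {Ω : Type*} (α : ℝ) (M₁ M₂ : ℝ≥0 → Ω → ℕ) (L D : ℝ≥0 → Ω → ℝ≥0)
    (t : ℝ≥0) (ω : Ω) : ℤ :=
  gfsp α (gsp M₁ M₂) (firstPassage L) (D t ω) ω

/-- Independence of two stochastic processes, regarded as random elements of the path spaces with
the product `σ`-algebras. -/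
def IndepProcesses {Ω β γ : Type*} [MeasurableSpace Ω] [MeasurableSpace β] [MeasurableSpace γ]
    (X : ℝ≥0 → Ω → β) (Y : ℝ≥0 → Ω → γ) (P : Measure Ω) : Prop :=
  IndepFun (fun ω t => X t ω) (fun ω t => Y t ω) P

/-- The correlation coefficient of two square-integrable random variables. -/
def corr {Ω : Type*} [MeasurableSpace Ω] (X Y : Ω → ℝ) (P : Measure Ω) : ℝ :=
  covariance X Y P / Real.sqrt (variance X P * variance Y P)

/-- For every fixed `s > 0`, `Corr(X(s), X(t)) ~ c(s) t ^ (-γ)` as `t → ∞`, with some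
`c(s) > 0`. -/
def CorrDecay {Ω : Type*} [MeasurableSpace Ω] (X : ℝ≥0 → Ω → ℝ) (γ : ℝ) (P : Measure Ω) : Prop :=
  ∀ s : ℝ≥0, 0 < s → ∃ c : ℝ, 0 < c ∧
    (fun t : ℝ≥0 => corr (X s) (X t) P) ~[atTop] (fun t : ℝ≥0 => c * (t : ℝ) ^ (-γ))

/-- Stationarity in the wide sense: mean and covariance are invariant under time shifts. A process
with finite second moments that is not stationary in this sense is not strictly stationary
either. -/
def IsWeaklyStationary {Ω : Type*} [MeasurableSpace Ω] (X : ℝ≥0 → Ω → ℝ) (P : Measure Ω) : Prop :=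
  (∀ t h : ℝ≥0, ∫ ω, X (t + h) ω ∂P = ∫ ω, X t ω ∂P) ∧
    ∀ s t h : ℝ≥0, covariance (X (s + h)) (X (t + h)) P = covariance (X s) (X t) P

/-- The long-range dependence property: `X` is a non-stationary process with finite second moments
and, for some `γ ∈ (0, 1)` and all fixed `s > 0`, `Corr(X(s), X(t)) ~ c(s) t ^ (-γ)` as `t → ∞`
with `c(s) > 0`. -/
structure HasLRD {Ω : Type*} [MeasurableSpace Ω] (X : ℝ≥0 → Ω → ℝ) (P : Measure Ω) : Prop where
  memLp : ∀ t, MemLp (X t) 2 P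
  nonstationary : ¬ IsWeaklyStationary X P
  decay : ∃ γ : ℝ, 0 < γ ∧ γ < 1 ∧ CorrDecay X γ P

end

end Skellam

namespace Skellam

open scoped ENNReal BoundedContinuousFunction

/-! Write `m` and `v` for the mean and variance of the generalized Skellam process at time 1, `Y`
for the inverse stable subordinator, `c = E Y(1)`, `b = E Y(1)^2`, and `Z` for the time-changed
process. For fixed `s`, the covariance of `Z(s)` and `Z(t)` converges to a positive constant, while
`Var Z(t)` grows like `t^(2γ)`. The correlation therefore decays like `t^(-γ)`
(`corrDecay_of_tendsto`), and the growth of the variance excludes stationarity.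

Freezing independent random times (`integrable_comp_random_times`) reduces moments of `Z` to those
of the counting processes, `Y` and `D`. The former come from their Laplace transform.
Self-similarity gives `E Y(x) = c x^α` and `E Y(x)^2 = b x^(2α)`. The mixed moment `E Y(x)Y(x+d)` is
not computed: a layer-cake formula for `Y(x)Y(x+d) - Y(x)^2/2` and the independent increments of the
stable subordinator put it between `b x^(2α)/2 + c^2 x^α d^α` and `b x^(2α)/2 + c^2 x^α (x+d)^α`
(`integral_firstPassage_mul_bounds`). After averaging over `D`, both bounds give the same limit of
the covariance, `v c E D(s)^α + m^2 b E D(s)^(2α) / 2`, because increments of `y^α` over intervals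
of fixed length vanish at infinity when `α < 1` (`tendsto_moment_differences`).

Finally, `Var Z(t) = v c E D(t)^α + m^2 (b E D(t)^(2α) - c^2 (E D(t)^α)^2)`. If `m ≠ 0`, the second
term dominates, with coefficient `m^2 (b k₂ - c^2 k₁^2) > 0` since `k₂ ≥ k₁^2` and `b > c^2`
(`sq_integral_firstPassage_one_lt`); thus `γ = ρ`. If `m = 0`, only the first term is left and `γ =
ρ/2`. For `α = 1` the hypotheses are contradictory, since the mean of an integrable subordinator is
linear in time. -/

/-! ### Laplace transforms determine laws on the half-line -/

/-- The bounded continuous function `x ↦ exp (-x)` on `[0, ∞)`. -/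
noncomputable def expNegBCF : ℝ≥0 →ᵇ ℝ :=
  BoundedContinuousFunction.ofNormedAddCommGroup (fun x : ℝ≥0 => Real.exp (-(x : ℝ)))
    (by fun_prop) 1 (fun x => by simp)

lemma expNegBCF_pow_apply (n : ℕ) (x : ℝ≥0) :
    (expNegBCF ^ n) x = Real.exp (-(n : ℝ) * (x : ℝ)) := by
  rw [BoundedContinuousFunction.coe_pow, Pi.pow_apply]
  change Real.exp (-(x : ℝ)) ^ n = _
  rw [← Real.exp_nat_mul]
  ring_nf

/-- A probability measure on `[0, ∞)` is determined by its Laplace transform. -/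
theorem ext_of_laplace {μ ν : Measure ℝ≥0} [IsProbabilityMeasure μ] [IsProbabilityMeasure ν]
    (h : ∀ s : ℝ, 0 < s → ∫ x, Real.exp (-s * (x : ℝ)) ∂μ = ∫ x, Real.exp (-s * (x : ℝ)) ∂ν) :
    μ = ν := by
  let A : StarSubalgebra ℝ (ℝ≥0 →ᵇ ℝ) :=
    { Algebra.adjoin ℝ {expNegBCF} with
      star_mem' := fun {a} ha => by
        have : star a = a := by ext x; simp
        rw [this]; exact ha }
  have hA : ∀ g ∈ A, g ∈ Algebra.adjoin ℝ {expNegBCF} := fun g hg => hg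
  refine ext_of_forall_mem_subalgebra_integral_eq_of_polish (𝕜 := ℝ) (A := A) ?_ ?_
  · intro x y hxy
    refine ⟨expNegBCF, ⟨expNegBCF.toContinuousMap, ⟨expNegBCF, ?_, rfl⟩, rfl⟩, ?_⟩
    · exact Algebra.subset_adjoin (Set.mem_singleton _)
    · change Real.exp (-(x : ℝ)) ≠ Real.exp (-(y : ℝ))
      intro h'
      exact hxy (NNReal.coe_injective (neg_injective (Real.exp_injective h')))
  · intro g hg
    have hg' := hA g hg
    rw [Algebra.adjoin_singleton_eq_range_aeval] at hg'
    obtain ⟨p, rfl⟩ := hg'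
    change ∫ x, (Polynomial.aeval expNegBCF p) x ∂μ = ∫ x, (Polynomial.aeval expNegBCF p) x ∂ν
    induction p using Polynomial.induction_on' with
    | add p q hp hq =>
      simp only [map_add, BoundedContinuousFunction.coe_add, Pi.add_apply]
      rw [integral_add (BoundedContinuousFunction.integrable _ _)
        (BoundedContinuousFunction.integrable _ _), integral_add
        (BoundedContinuousFunction.integrable _ _) (BoundedContinuousFunction.integrable _ _),
        hp (by
          change _ ∈ Algebra.adjoin ℝ {expNegBCF}
          rw [Algebra.adjoin_singleton_eq_range_aeval]; exact ⟨p, rfl⟩),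
        hq (by
          change _ ∈ Algebra.adjoin ℝ {expNegBCF}
          rw [Algebra.adjoin_singleton_eq_range_aeval]; exact ⟨q, rfl⟩)]
    -- On monomials the hypothesis is needed only at integer arguments; the constant term agrees
    -- because both measures have mass one.
    | monomial n a =>
      simp only [Polynomial.aeval_monomial, ← Algebra.smul_def,
        BoundedContinuousFunction.coe_smul, smul_eq_mul, integral_const_mul, expNegBCF_pow_apply]
      congr 1
      rcases Nat.eq_zero_or_pos n with rfl | hn
      · simp
      · exact h n (by exact_mod_cast hn)

/-! ### Right-continuous paths from countably many coordinates -/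

/-- A point of the grid of mesh `1 / (n + 1)` to the right of `t`. -/
noncomputable def rightGrid (i : ℕ × ℕ) : ℝ≥0 := (i.2 + 1 : ℝ≥0) / (i.1 + 1)

/-- Recovers the value at `t` of a right-continuous path from its values on the grid points. -/
noncomputable def gridEval (p : ℕ × ℕ → ℝ) (t : ℝ≥0) : ℝ :=
  -- A `limsup` is defined and measurable for every family of grid values, whether or not it comes
  -- from a right-continuous path. The `+ 1` in the numerator of `rightGrid` keeps the grid points
  -- to the right of `t`.
  limsup (fun n : ℕ => p (n, ⌊(n + 1 : ℝ≥0) * t⌋₊)) atTop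

lemma measurable_gridEval : Measurable (fun z : (ℕ × ℕ → ℝ) × ℝ≥0 => gridEval z.1 z.2) := by
  unfold gridEval
  refine Measurable.limsup fun n => ?_
  have h1 : Measurable (fun z : (ℕ × ℕ → ℝ) × ℕ => z.1 (n, z.2)) :=
    measurable_from_prod_countable_left fun j => measurable_pi_apply (n, j)
  exact h1.comp (measurable_fst.prodMk (Nat.measurable_floor.comp (measurable_snd.const_mul _)))

lemma tendsto_rightGrid (t : ℝ≥0) :
    Tendsto (fun n : ℕ => rightGrid (n, ⌊(n + 1 : ℝ≥0) * t⌋₊)) atTop (𝓝[≥] t) := by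
  have hpos : ∀ n : ℕ, (0 : ℝ≥0) < n + 1 := fun n => by positivity
  refine tendsto_nhdsWithin_iff.2 ⟨?_, Eventually.of_forall fun n => ?_⟩
  · have h2 : Tendsto (fun n : ℕ => t + 1 / ((n : ℝ≥0) + 1)) atTop (𝓝 (t + 0)) :=
      tendsto_const_nhds.add tendsto_one_div_add_atTop_nhds_zero_nat
    rw [add_zero] at h2
    refine tendsto_of_tendsto_of_tendsto_of_le_of_le tendsto_const_nhds h2 (fun n => ?_)
      (fun n => ?_)
    · change t ≤ _ / _
      rw [le_div_iff₀ (hpos n), mul_comm]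
      exact (Nat.lt_floor_add_one _).le
    · change _ / _ ≤ _
      rw [div_le_iff₀ (hpos n), add_mul t, one_div, inv_mul_cancel₀ (hpos n).ne', mul_comm t]
      exact add_le_add_left (Nat.floor_le (by positivity)) 1
  · change t ≤ _ / _
    rw [le_div_iff₀ (hpos n), mul_comm]
    exact (Nat.lt_floor_add_one _).le

lemma gridEval_eq {x : ℝ≥0 → ℝ} (hx : ∀ t, ContinuousWithinAt x (Set.Ici t) t) (t : ℝ≥0) :
    gridEval (fun i => x (rightGrid i)) t = x t :=
  ((hx t).tendsto.comp (tendsto_rightGrid t)).limsup_eq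

attribute [irreducible] gridEval rightGrid

/-! ### Processes evaluated at independent random times -/

section Composition

variable {Ω : Type*} [MeasurableSpace Ω] {P : Measure Ω} [IsProbabilityMeasure P]
  {X : ℝ≥0 → Ω → ℝ} {T : Ω → ℝ≥0 × ℝ≥0}

omit [IsProbabilityMeasure P] in
lemma ae_eq_gridEval
    (hrc : ∀ᵐ ω ∂P, ∀ t, ContinuousWithinAt (fun u => X u ω) (Set.Ici t) t) :
    ∀ᵐ ω ∂P, ∀ t, X t ω = gridEval (fun i => X (rightGrid i) ω) t := by
  filter_upwards [hrc] with ω hω t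
  exact (gridEval_eq hω t).symm

omit [IsProbabilityMeasure P] in
lemma aemeasurable_gridPath (hX : ∀ t, AEMeasurable (X t) P) :
    AEMeasurable (fun ω i => X (rightGrid i) ω) P :=
  aemeasurable_pi_iff.2 fun _ => hX _

omit [IsProbabilityMeasure P] in
lemma aemeasurable_comp_random_time (hX : ∀ t, AEMeasurable (X t) P)
    (hrc : ∀ᵐ ω ∂P, ∀ t, ContinuousWithinAt (fun u => X u ω) (Set.Ici t) t)
    {τ : Ω → ℝ≥0} (hτ : AEMeasurable τ P) : AEMeasurable (fun ω => X (τ ω) ω) P := by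
  have h1 : AEMeasurable (fun ω => gridEval (fun i => X (rightGrid i) ω) (τ ω)) P :=
    measurable_gridEval.comp_aemeasurable ((aemeasurable_gridPath hX).prodMk hτ)
  refine h1.congr ?_
  filter_upwards [ae_eq_gridEval hrc] with ω hω
  exact (hω _).symm

/-- Evaluation at a random time is not measurable on the full path space, but it is measurable on
the countable grid path. Independence therefore has to be passed to the grid before Fubini can be
used. -/
lemma map_gridPath_prod (hX : ∀ t, AEMeasurable (X t) P) (hT : AEMeasurable T P)
    (hind : IndepFun (fun ω t => X t ω) T P) :
    P.map (fun ω => ((fun i => X (rightGrid i) ω), T ω)) =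
      (P.map (fun ω i => X (rightGrid i) ω)).prod (P.map T) := by
  have h : IndepFun (fun ω i => X (rightGrid i) ω) T P :=
    hind.comp (φ := fun (p : ℝ≥0 → ℝ) i => p (rightGrid i)) (ψ := id)
      (measurable_pi_lambda _ fun i => measurable_pi_apply _) measurable_id
  exact h.map_prod_eq_prod_map_map (aemeasurable_gridPath hX) hT

lemma measurable_gridEval_pair {E : Type*} [MeasurableSpace E] {φ : ℝ × ℝ → E}
    (hφ : Measurable φ) :
    Measurable (fun z : (ℕ × ℕ → ℝ) × ℝ≥0 × ℝ≥0 => φ (gridEval z.1 z.2.1, gridEval z.1 z.2.2)) :=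
  hφ.comp ((measurable_gridEval.comp
    (measurable_fst.prodMk (measurable_fst.comp measurable_snd))).prodMk
    (measurable_gridEval.comp (measurable_fst.prodMk (measurable_snd.comp measurable_snd))))

/-- The expectation of a function of a right-continuous process at independent random times can be
computed by first freezing the times. -/
theorem lintegral_comp_random_times (hX : ∀ t, AEMeasurable (X t) P)
    (hrc : ∀ᵐ ω ∂P, ∀ t, ContinuousWithinAt (fun u => X u ω) (Set.Ici t) t)
    (hT : AEMeasurable T P) (hind : IndepFun (fun ω t => X t ω) T P)
    {φ : ℝ × ℝ → ℝ≥0∞} (hφ : Measurable φ) :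
    ∫⁻ ω, φ (X (T ω).1 ω, X (T ω).2 ω) ∂P =
      ∫⁻ ω', ∫⁻ ω, φ (X (T ω').1 ω, X (T ω').2 ω) ∂P ∂P := by
  have hG := measurable_gridEval_pair hφ
  have hp := aemeasurable_gridPath (P := P) hX
  have hae := ae_eq_gridEval hrc
  calc ∫⁻ ω, φ (X (T ω).1 ω, X (T ω).2 ω) ∂P
      = ∫⁻ ω, φ (gridEval (fun i => X (rightGrid i) ω) (T ω).1,
          gridEval (fun i => X (rightGrid i) ω) (T ω).2) ∂P := by
        refine lintegral_congr_ae ?_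
        filter_upwards [hae] with ω hω
        rw [hω, hω]
    _ = ∫⁻ z, φ (gridEval z.1 z.2.1, gridEval z.1 z.2.2)
          ∂(P.map (fun ω => ((fun i => X (rightGrid i) ω), T ω))) := by
        rw [lintegral_map' hG.aemeasurable (hp.prodMk hT)]
    _ = ∫⁻ t, ∫⁻ p, φ (gridEval p t.1, gridEval p t.2) ∂(P.map (fun ω i => X (rightGrid i) ω))
          ∂(P.map T) := by
        rw [map_gridPath_prod hX hT hind, lintegral_prod_symm' _ hG]
    _ = ∫⁻ ω', ∫⁻ p, φ (gridEval p (T ω').1, gridEval p (T ω').2)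
          ∂(P.map (fun ω i => X (rightGrid i) ω)) ∂P := by
        rw [lintegral_map' (Measurable.lintegral_prod_left' hG).aemeasurable hT]
    _ = _ := by
        refine lintegral_congr fun ω' => ?_
        refine (lintegral_map' (hG.comp (measurable_prodMk_right (y := T ω'))).aemeasurable
          hp).trans ?_
        refine lintegral_congr_ae ?_
        filter_upwards [hae] with ω hω
        simp only [Function.comp_apply, ← hω]

theorem integrable_comp_random_times (hX : ∀ t, AEMeasurable (X t) P)
    (hrc : ∀ᵐ ω ∂P, ∀ t, ContinuousWithinAt (fun u => X u ω) (Set.Ici t) t)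
    (hT : AEMeasurable T P) (hind : IndepFun (fun ω t => X t ω) T P)
    {φ : ℝ × ℝ → ℝ} (hφ : Measurable φ)
    (hint : Integrable (fun ω => φ (X (T ω).1 ω, X (T ω).2 ω)) P) :
    Integrable (fun ω' => ∫ ω, φ (X (T ω').1 ω, X (T ω').2 ω) ∂P) P ∧
    ∫ ω, φ (X (T ω).1 ω, X (T ω).2 ω) ∂P =
      ∫ ω', ∫ ω, φ (X (T ω').1 ω, X (T ω').2 ω) ∂P ∂P := by
  have hG := measurable_gridEval_pair hφ
  have hp := aemeasurable_gridPath (P := P) hX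
  have hae := ae_eq_gridEval hrc
  have e1 : (fun ω => φ (X (T ω).1 ω, X (T ω).2 ω)) =ᵐ[P]
      fun ω => φ (gridEval (fun i => X (rightGrid i) ω) (T ω).1,
          gridEval (fun i => X (rightGrid i) ω) (T ω).2) := by
    filter_upwards [hae] with ω hω
    rw [hω, hω]
  have e2 : ∀ ω', ∫ ω, φ (X (T ω').1 ω, X (T ω').2 ω) ∂P =
      ∫ p, φ (gridEval p (T ω').1, gridEval p (T ω').2)
        ∂(P.map (fun ω i => X (rightGrid i) ω)) := by
    intro ω'
    refine Eq.symm <| (integral_map hp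
      (hG.comp (measurable_prodMk_right (y := T ω'))).aestronglyMeasurable).trans ?_
    refine integral_congr_ae ?_
    filter_upwards [hae] with ω hω
    simp only [Function.comp_apply, ← hω]
  have hint2 : Integrable (fun z : (ℕ × ℕ → ℝ) × ℝ≥0 × ℝ≥0 =>
      φ (gridEval z.1 z.2.1, gridEval z.1 z.2.2))
      ((P.map (fun ω i => X (rightGrid i) ω)).prod (P.map T)) := by
    rw [← map_gridPath_prod hX hT hind,
      integrable_map_measure hG.aestronglyMeasurable (hp.prodMk hT)]
    exact hint.congr e1
  have : IsProbabilityMeasure (P.map T) := Measure.isProbabilityMeasure_map hT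
  have : IsProbabilityMeasure (P.map (fun ω i => X (rightGrid i) ω)) :=
    Measure.isProbabilityMeasure_map hp
  have hint3 := hint2.integral_prod_right
  simp_rw [e2]
  refine ⟨hint3.comp_aemeasurable hT, ?_⟩
  rw [integral_congr_ae e1, ← integral_map (φ := fun ω => ((fun i => X (rightGrid i) ω), T ω))
    (f := fun z : (ℕ × ℕ → ℝ) × ℝ≥0 × ℝ≥0 => φ (gridEval z.1 z.2.1, gridEval z.1 z.2.2))
    (hp.prodMk hT) hG.aestronglyMeasurable, map_gridPath_prod hX hT hind,
    integral_prod_symm _ hint2]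
  rw [integral_map hT hint3.aestronglyMeasurable]

end Composition

/-! ### Layer-cake comparisons -/

section Order

variable {Ω : Type*} [MeasurableSpace Ω] {P : Measure Ω}

/-- The layer-cake formula may be written with strict or with weak tails, so comparing a strict tail
with a weak one is enough. This is the form available for first passages, where `{L u ≤ x}` lies, up
to a null set, between `{u < Y(x)}` and `{u ≤ Y(x)}`. -/
lemma lintegral_le_of_meas_lt_le_meas_le {A B : Ω → ℝ≥0} (hA : AEMeasurable A P)
    (hB : AEMeasurable B P) (h : ∀ u, P {ω | u < A ω} ≤ P {ω | u ≤ B ω}) :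
    ∫⁻ ω, ENNReal.ofReal (A ω) ∂P ≤ ∫⁻ ω, ENNReal.ofReal (B ω) ∂P := by
  rw [lintegral_eq_lintegral_meas_lt P (f := fun ω => (A ω : ℝ)) (.of_forall fun _ => by simp)
    hA.coe_nnreal_real, lintegral_eq_lintegral_meas_le P (f := fun ω => (B ω : ℝ))
    (.of_forall fun _ => by simp) hB.coe_nnreal_real]
  refine setLIntegral_mono' measurableSet_Ioi fun u hu => ?_
  lift u to ℝ≥0 using le_of_lt hu
  exact_mod_cast h u

lemma lintegral_sq_le_of_meas_lt_le_meas_le {A B : Ω → ℝ≥0} (hA : AEMeasurable A P)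
    (hB : AEMeasurable B P) (h : ∀ u, P {ω | u < A ω} ≤ P {ω | u ≤ B ω}) :
    ∫⁻ ω, ENNReal.ofReal ((A ω : ℝ) ^ 2) ∂P ≤ ∫⁻ ω, ENNReal.ofReal ((B ω : ℝ) ^ 2) ∂P := by
  have := lintegral_le_of_meas_lt_le_meas_le (A := fun ω => A ω ^ 2) (B := fun ω => B ω ^ 2)
    (hA.pow_const 2) (hB.pow_const 2) (P := P) (fun u => by
      have := h (NNReal.sqrt u)
      simpa only [NNReal.sqrt_le_iff_le_sq, lt_iff_not_ge, NNReal.le_sqrt_iff_sq_le] using this)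
  simpa using this

/-- This is the area of the trapezoid `0 < u < a`, `0 < w < b - u`. The coordinate `w` is the excess
over `u`, which will be matched with an increment of the subordinator. -/
lemma lintegral_mul_sub_sq_half_real_lt {a b : ℝ} (ha : 0 ≤ a) (hab : a ≤ b) :
    ∫⁻ u in Set.Ioi (0 : ℝ), ∫⁻ w in Set.Ioi (0 : ℝ),
      ({z : ℝ × ℝ | z.1 < a ∧ z.1 + z.2 < b}.indicator 1 (u, w) : ℝ≥0∞) =
      ENNReal.ofReal (a * b - a ^ 2 / 2) := by
  have h1 : ∀ u ∈ Set.Ioi (0 : ℝ), ∫⁻ w in Set.Ioi (0 : ℝ),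
      ({z : ℝ × ℝ | z.1 < a ∧ z.1 + z.2 < b}.indicator 1 (u, w) : ℝ≥0∞) =
      (Set.Iio a).indicator (fun u => ENNReal.ofReal (b - u)) u := by
    intro u hu
    by_cases hua : u < a
    · have : (fun w : ℝ => ({z : ℝ × ℝ | z.1 < a ∧ z.1 + z.2 < b}.indicator 1 (u, w) : ℝ≥0∞)) =
          (Set.Iio (b - u)).indicator 1 := by
        ext w
        simp only [Set.indicator, Set.mem_ofPred_eq, Set.mem_Iio, hua, true_and, lt_sub_iff_add_lt',
          Pi.one_apply]
      rw [this, lintegral_indicator_one measurableSet_Iio,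
        Measure.restrict_apply measurableSet_Iio, Set.indicator_of_mem (by exact hua)]
      rw [Set.inter_comm, Set.Ioi_inter_Iio, Real.volume_Ioo, sub_zero]
    · rw [Set.indicator_of_notMem (by exact hua)]
      simp [Set.indicator, hua]
  rw [setLIntegral_congr_fun measurableSet_Ioi h1, lintegral_indicator measurableSet_Iio,
    Measure.restrict_restrict measurableSet_Iio, Set.inter_comm, Set.Ioi_inter_Iio,
    ← ofReal_integral_eq_lintegral_ofReal]
  · congr 1
    rw [← integral_Ioc_eq_integral_Ioo, ← intervalIntegral.integral_of_le ha]
    rw [intervalIntegral.integral_sub (by simp) (by simp)]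
    simp
  · exact (Continuous.integrableOn_Icc (by fun_prop)).mono_set Set.Ioo_subset_Icc_self
  · refine (ae_restrict_mem measurableSet_Ioo).mono fun u hu => ?_
    simp only [Pi.zero_apply]
    linarith [hu.2]

lemma lintegral_mul_sub_sq_half_real_le {a b : ℝ} (ha : 0 ≤ a) (hab : a ≤ b) :
    ∫⁻ u in Set.Ioi (0 : ℝ), ∫⁻ w in Set.Ioi (0 : ℝ),
      ({z : ℝ × ℝ | z.1 ≤ a ∧ z.1 + z.2 ≤ b}.indicator 1 (u, w) : ℝ≥0∞) =
      ENNReal.ofReal (a * b - a ^ 2 / 2) := by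
  rw [← lintegral_mul_sub_sq_half_real_lt ha hab]
  refine lintegral_congr_ae (ae_restrict_of_ae ?_)
  -- The strict and weak regions differ only on the lines `u = a` and `u + w = b`, which are null.
  filter_upwards [measure_eq_zero_iff_ae_notMem.1 (measure_singleton (μ := volume) a)] with u hu
  refine lintegral_congr_ae (ae_restrict_of_ae ?_)
  filter_upwards [measure_eq_zero_iff_ae_notMem.1 (measure_singleton (μ := volume) (b - u))]
    with w hw
  have h1 : u ≤ a ↔ u < a := ⟨fun h => lt_of_le_of_ne h hu, le_of_lt⟩
  have h2 : u + w ≤ b ↔ u + w < b :=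
    ⟨fun h => lt_of_le_of_ne h fun h' => hw (by simp [← h']), le_of_lt⟩
  simp [Set.indicator, h1, h2]

lemma lintegral_indicator_swap [SFinite P] {A B : Ω → ℝ} (hA : Measurable A) (hB : Measurable B)
    {R : Set ((ℝ × ℝ) × ℝ × ℝ)} (hR : MeasurableSet R) :
    ∫⁻ ω, (∫⁻ u in Set.Ioi (0 : ℝ), ∫⁻ w in Set.Ioi (0 : ℝ),
      (R.indicator 1 ((u, w), (A ω, B ω)) : ℝ≥0∞)) ∂P =
    ∫⁻ u in Set.Ioi (0 : ℝ), ∫⁻ w in Set.Ioi (0 : ℝ), P {ω | ((u, w), (A ω, B ω)) ∈ R} := by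
  have hm : Measurable (fun z : Ω × ℝ × ℝ =>
      (R.indicator 1 ((z.2.1, z.2.2), (A z.1, B z.1)) : ℝ≥0∞)) :=
    (measurable_one.indicator hR).comp (by fun_prop)
  have hm1 : Measurable (fun z : Ω × ℝ => ∫⁻ w in Set.Ioi (0 : ℝ),
      (R.indicator 1 ((z.2, w), (A z.1, B z.1)) : ℝ≥0∞)) :=
    Measurable.lintegral_prod_right'
      (f := fun z : (Ω × ℝ) × ℝ => (R.indicator 1 ((z.1.2, z.2), (A z.1.1, B z.1.1)) : ℝ≥0∞))
      (hm.comp (show Measurable fun z : (Ω × ℝ) × ℝ => (z.1.1, z.1.2, z.2) by fun_prop))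
  rw [lintegral_lintegral_swap hm1.aemeasurable]
  refine lintegral_congr fun u => ?_
  have hm2 : Measurable (fun z : Ω × ℝ => (R.indicator 1 ((u, z.2), (A z.1, B z.1)) : ℝ≥0∞)) :=
    hm.comp (show Measurable fun z : Ω × ℝ => (z.1, u, z.2) by fun_prop)
  rw [lintegral_lintegral_swap hm2.aemeasurable]
  refine lintegral_congr fun w => ?_
  rw [← lintegral_indicator_one]
  · rfl
  · exact (show Measurable fun ω => ((u, w), (A ω, B ω)) by fun_prop) hR

/-- A layer-cake formula for `A B - A² / 2` when `0 ≤ A ≤ B`. -/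
lemma lintegral_mul_sub_sq_half_lt [SFinite P] {A B : Ω → ℝ≥0} (hA : AEMeasurable A P)
    (hB : AEMeasurable B P) (hAB : ∀ᵐ ω ∂P, A ω ≤ B ω) :
    ∫⁻ ω, ENNReal.ofReal ((A ω : ℝ) * B ω - (A ω : ℝ) ^ 2 / 2) ∂P =
    ∫⁻ u in Set.Ioi (0 : ℝ), ∫⁻ w in Set.Ioi (0 : ℝ), P {ω | u < A ω ∧ u + w < B ω} := by
  have hR1 : MeasurableSet {z : (ℝ × ℝ) × ℝ × ℝ | z.1.1 < z.2.1} :=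
    measurableSet_lt (by fun_prop) (by fun_prop)
  have hR2 : MeasurableSet {z : (ℝ × ℝ) × ℝ × ℝ | z.1.1 + z.1.2 < z.2.2} :=
    measurableSet_lt (by fun_prop) (by fun_prop)
  have hR : MeasurableSet {z : (ℝ × ℝ) × ℝ × ℝ | z.1.1 < z.2.1 ∧ z.1.1 + z.1.2 < z.2.2} :=
    hR1.inter hR2
  have hmA := hA.measurable_mk.coe_nnreal_real
  have hmB := hB.measurable_mk.coe_nnreal_real
  have key := lintegral_indicator_swap (P := P) hmA hmB hR
  have e : ∀ᵐ ω ∂P, A ω = hA.mk A ω ∧ B ω = hB.mk B ω := hA.ae_eq_mk.and hB.ae_eq_mk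
  calc _ = _ := lintegral_congr_ae (by
        filter_upwards [hAB, e] with ω h1 h2
        rw [← lintegral_mul_sub_sq_half_real_lt (by simp) (by exact_mod_cast h1), h2.1, h2.2]
        rfl)
    _ = _ := key
    _ = _ := by
        refine lintegral_congr fun u => lintegral_congr fun w => measure_congr ?_
        filter_upwards [e] with ω h2
        change (_ ∧ _) = (_ ∧ _)
        rw [h2.1, h2.2]

lemma lintegral_mul_sub_sq_half_le [SFinite P] {A B : Ω → ℝ≥0} (hA : AEMeasurable A P)
    (hB : AEMeasurable B P) (hAB : ∀ᵐ ω ∂P, A ω ≤ B ω) :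
    ∫⁻ ω, ENNReal.ofReal ((A ω : ℝ) * B ω - (A ω : ℝ) ^ 2 / 2) ∂P =
    ∫⁻ u in Set.Ioi (0 : ℝ), ∫⁻ w in Set.Ioi (0 : ℝ), P {ω | u ≤ A ω ∧ u + w ≤ B ω} := by
  have hR1 : MeasurableSet {z : (ℝ × ℝ) × ℝ × ℝ | z.1.1 ≤ z.2.1} :=
    measurableSet_le (by fun_prop) (by fun_prop)
  have hR2 : MeasurableSet {z : (ℝ × ℝ) × ℝ × ℝ | z.1.1 + z.1.2 ≤ z.2.2} :=
    measurableSet_le (by fun_prop) (by fun_prop)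
  have hR : MeasurableSet {z : (ℝ × ℝ) × ℝ × ℝ | z.1.1 ≤ z.2.1 ∧ z.1.1 + z.1.2 ≤ z.2.2} :=
    hR1.inter hR2
  have hmA := hA.measurable_mk.coe_nnreal_real
  have hmB := hB.measurable_mk.coe_nnreal_real
  have key := lintegral_indicator_swap (P := P) hmA hmB hR
  have e : ∀ᵐ ω ∂P, A ω = hA.mk A ω ∧ B ω = hB.mk B ω := hA.ae_eq_mk.and hB.ae_eq_mk
  calc _ = _ := lintegral_congr_ae (by
        filter_upwards [hAB, e] with ω h1 h2
        rw [← lintegral_mul_sub_sq_half_real_le (by simp) (by exact_mod_cast h1), h2.1, h2.2]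
        rfl)
    _ = _ := key
    _ = _ := by
        refine lintegral_congr fun u => lintegral_congr fun w => measure_congr ?_
        filter_upwards [e] with ω h2
        change (_ ∧ _) = (_ ∧ _)
        rw [h2.1, h2.2]

end Order

/-! ### First passage times of a single path -/

section FirstPassagePath

variable {Ω : Type*} {L : ℝ≥0 → Ω → ℝ≥0} {ω : Ω}

lemma apply_le_of_lt_firstPassage {u t : ℝ≥0} (h : u < firstPassage L t ω) : L u ω ≤ t :=
  not_lt.1 fun h' => notMem_of_lt_csInf h (OrderBot.bddBelow _) h'

/-- The infimum of the empty set in `ℝ≥0` is `0`, so monotonicity and lower bounds for the first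
passage need the path to be unbounded. -/
lemma firstPassage_nonempty (htop : Tendsto (fun t => L t ω) atTop atTop) (t : ℝ≥0) :
    {x : ℝ≥0 | t < L x ω}.Nonempty :=
  (htop.eventually_gt_atTop t).exists

lemma le_firstPassage_of_apply_le (hmono : Monotone (fun t => L t ω))
    (htop : Tendsto (fun t => L t ω) atTop atTop) {u t : ℝ≥0} (h : L u ω ≤ t) :
    u ≤ firstPassage L t ω :=
  le_csInf (firstPassage_nonempty htop t) fun _ hb =>
    le_of_lt (hmono.reflect_lt (lt_of_le_of_lt h hb))

lemma monotone_firstPassage (htop : Tendsto (fun t => L t ω) atTop atTop) :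
    Monotone (fun t => firstPassage L t ω) := fun _ t hst =>
  csInf_le_csInf (OrderBot.bddBelow _) (firstPassage_nonempty htop t) fun _ hx =>
    lt_of_le_of_lt hst hx

/-- If `L x > t` for some `x < a`, the same `x` witnesses passage above every level slightly larger
than `t`. -/
lemma firstPassage_continuousWithinAt (htop : Tendsto (fun t => L t ω) atTop atTop) (t : ℝ≥0) :
    ContinuousWithinAt (fun t => firstPassage L t ω) (Set.Ici t) t := by
  have hm := monotone_firstPassage htop
  refine tendsto_order.2 ⟨fun a ha => ?_, fun a ha => ?_⟩
  · filter_upwards [self_mem_nhdsWithin] with u hu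
    exact lt_of_lt_of_le ha (hm hu)
  · obtain ⟨x, hx, hxa⟩ := exists_lt_of_csInf_lt (firstPassage_nonempty htop t) ha
    filter_upwards [mem_nhdsWithin_of_mem_nhds (Iio_mem_nhds (show t < L x ω from hx))] with u hu
    exact lt_of_le_of_lt (csInf_le (OrderBot.bddBelow _) hu) hxa

/-- The composition of a right-continuous path with the first passage times is right-continuous. -/
lemma continuousWithinAt_comp_firstPassage (htop : Tendsto (fun t => L t ω) atTop atTop)
    {x : ℝ≥0 → ℝ} (hx : ∀ t, ContinuousWithinAt x (Set.Ici t) t) (t : ℝ≥0) :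
    ContinuousWithinAt (fun t => x (firstPassage L t ω)) (Set.Ici t) t :=
  (hx _).comp (firstPassage_continuousWithinAt htop t) fun _ hu => monotone_firstPassage htop hu

/-- Measurability of the first passage needs a countable infimum. Monotonicity lets any passage
point be moved up to a nearby dense one; the value `⊤` makes the other indices irrelevant. -/
lemma coe_firstPassage_eq_iInf (hmono : Monotone (fun t => L t ω))
    (htop : Tendsto (fun t => L t ω) atTop atTop) (t : ℝ≥0) :
    (firstPassage L t ω : ℝ≥0∞) = ⨅ n : ℕ, open Classical in
      if t < L (TopologicalSpace.denseSeq ℝ≥0 n) ω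
        then ((TopologicalSpace.denseSeq ℝ≥0 n : ℝ≥0) : ℝ≥0∞) else ⊤ := by
  classical
  refine le_antisymm (le_iInf fun n => ?_) (le_of_forall_gt fun a ha => ?_)
  · split_ifs with h
    · exact ENNReal.coe_le_coe.2 (csInf_le (OrderBot.bddBelow _) h)
    · exact le_top
  · obtain ⟨b, hb, hba⟩ := ENNReal.lt_iff_exists_nnreal_btwn.1 ha
    obtain ⟨x, hx, hxb⟩ := exists_lt_of_csInf_lt (firstPassage_nonempty htop t)
      (ENNReal.coe_lt_coe.1 hb)
    obtain ⟨n, hn⟩ := (TopologicalSpace.denseRange_denseSeq ℝ≥0).exists_mem_open isOpen_Ioo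
      (Set.nonempty_Ioo.2 hxb)
    refine lt_of_le_of_lt (iInf_le _ n) ?_
    rw [if_pos (lt_of_lt_of_le hx (hmono hn.1.le))]
    exact lt_trans (ENNReal.coe_lt_coe.2 hn.2) hba

end FirstPassagePath

/-! ### Divergence and measurability for subordinators -/

section Subordinator

variable {Ω : Type*} [MeasurableSpace Ω] {P : Measure Ω} [IsProbabilityMeasure P]
  {D : ℝ≥0 → Ω → ℝ≥0}

omit [IsProbabilityMeasure P] in
lemma IsSubordinator.measurable (hD : IsSubordinator D P) (t : ℝ≥0) : Measurable (D t) :=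
  measurable_coe_nnreal_real_iff.1 (hD.levy.measurable t)

/-- Along the integers `exp (-D n)` is almost surely decreasing; vanishing integrals then force it
to tend to zero almost surely. -/
lemma IsSubordinator.tendsto_atTop (hD : IsSubordinator D P)
    (h : Tendsto (fun n : ℕ => ∫ ω, Real.exp (-(D n ω : ℝ)) ∂P) atTop (𝓝 0)) :
    ∀ᵐ ω ∂P, Tendsto (fun t => D t ω) atTop atTop := by
  have hint : ∀ n : ℕ, Integrable (fun ω => Real.exp (-(D n ω : ℝ))) P := fun n =>
    Integrable.of_bound ((hD.levy.measurable n).neg.exp).aestronglyMeasurable 1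
      (.of_forall fun ω => by simp)
  have h1 := tendsto_of_integral_tendsto_of_antitone hint (integrable_zero Ω ℝ P) (by simpa using h)
    (by
      filter_upwards [hD.monotone] with ω hω i j hij
      simpa using hω (show (i : ℝ≥0) ≤ j by exact_mod_cast hij))
    (.of_forall fun ω i => (Real.exp_pos _).le)
  filter_upwards [h1, hD.monotone] with ω hω hmono
  have h2 : Tendsto (fun n : ℕ => (D n ω : ℝ)) atTop atTop := by
    have := Real.tendsto_exp_comp_nhds_zero.1 hω
    exact tendsto_neg_atBot_iff.1 this
  refine tendsto_atTop_atTop_of_monotone hmono fun b => ?_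
  obtain ⟨n, hn⟩ := (h2.eventually_ge_atTop (b : ℝ)).exists
  exact ⟨n, by exact_mod_cast hn⟩

omit [IsProbabilityMeasure P] in
lemma IsSubordinator.aemeasurable_firstPassage (hD : IsSubordinator D P)
    (htop : ∀ᵐ ω ∂P, Tendsto (fun t => D t ω) atTop atTop) (t : ℝ≥0) :
    AEMeasurable (firstPassage D t) P := by
  classical
  have hm : Measurable (fun ω => ⨅ n : ℕ, if t < D (TopologicalSpace.denseSeq ℝ≥0 n) ω
        then ((TopologicalSpace.denseSeq ℝ≥0 n : ℝ≥0) : ℝ≥0∞) else ⊤) :=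
    Measurable.iInf fun n => Measurable.ite
      (measurableSet_lt measurable_const (hD.measurable _)) measurable_const measurable_const
  refine ⟨_, hm.ennreal_toNNReal, ?_⟩
  filter_upwards [htop, hD.monotone] with ω h1 h2
  have := coe_firstPassage_eq_iInf h2 h1 t
  rw [← ENNReal.toNNReal_coe (firstPassage D t ω), this]

end Subordinator

/-! ### Self-similarity and moments of the inverse stable subordinator -/

section InverseStable

variable {Ω : Type*} [MeasurableSpace Ω] {P : Measure Ω} [IsProbabilityMeasure P]
  {α : ℝ} {L : ℝ≥0 → Ω → ℝ≥0}

namespace IsStableSubordinator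

lemma tendsto_atTop (hL : IsStableSubordinator α L P) :
    ∀ᵐ ω ∂P, Tendsto (fun t => L t ω) atTop atTop := by
  refine hL.subordinator.tendsto_atTop ?_
  have h : ∀ n : ℕ, ∫ ω, Real.exp (-(L n ω : ℝ)) ∂P = Real.exp (-(n : ℝ)) := fun n => by
    simpa using hL.laplace n 1 one_pos
  simp_rw [h]
  exact Real.tendsto_exp_comp_nhds_zero.2
    (tendsto_neg_atTop_atBot.comp tendsto_natCast_atTop_atTop)

lemma aemeasurable_firstPassage (hL : IsStableSubordinator α L P) (x : ℝ≥0) :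
    AEMeasurable (firstPassage L x) P :=
  hL.subordinator.aemeasurable_firstPassage hL.tendsto_atTop x

lemma ae_firstPassage_mono (hL : IsStableSubordinator α L P) :
    ∀ᵐ ω ∂P, Monotone (fun t => firstPassage L t ω) :=
  hL.tendsto_atTop.mono fun _ h => monotone_firstPassage h

omit [IsProbabilityMeasure P] in
lemma meas_lt_firstPassage_le (L : ℝ≥0 → Ω → ℝ≥0) (u x : ℝ≥0) :
    P {ω | u < firstPassage L x ω} ≤ P {ω | L u ω ≤ x} :=
  measure_mono fun _ h => apply_le_of_lt_firstPassage h

lemma meas_le_meas_le_firstPassage (hL : IsStableSubordinator α L P) (u x : ℝ≥0) :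
    P {ω | L u ω ≤ x} ≤ P {ω | u ≤ firstPassage L x ω} := by
  refine measure_mono_ae ?_
  filter_upwards [hL.tendsto_atTop, hL.subordinator.monotone] with ω h1 h2 h
  exact le_firstPassage_of_apply_le h2 h1 h

/-- Self-similarity of the stable subordinator. -/
lemma meas_le_scale (hL : IsStableSubordinator α L P) (u : ℝ≥0) {x : ℝ≥0} (hx : 0 < x) :
    P {ω | L u ω ≤ x} = P {ω | L (u * x ^ (-α)) ω ≤ 1} := by
  have hm1 : Measurable (fun ω => x⁻¹ * L u ω) := (hL.subordinator.measurable u).const_mul _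
  have hm2 := hL.subordinator.measurable (u * x ^ (-α))
  have hx' : (0 : ℝ) < x := hx
  have := Measure.isProbabilityMeasure_map (μ := P) hm1.aemeasurable
  have := Measure.isProbabilityMeasure_map (μ := P) hm2.aemeasurable
  -- Both laws have Laplace transform `exp (-u (s / x)^α)`.
  have key : P.map (fun ω => x⁻¹ * L u ω) = P.map (L (u * x ^ (-α))) := by
    refine ext_of_laplace fun s hs => ?_
    rw [integral_map hm1.aemeasurable (by fun_prop), integral_map hm2.aemeasurable (by fun_prop),
      hL.laplace _ s hs]
    have : ∀ ω, -s * ((x⁻¹ * L u ω : ℝ≥0) : ℝ) = -(s / x) * (L u ω : ℝ) := fun ω => by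
      push_cast; ring
    simp_rw [this]
    rw [hL.laplace u (s / x) (by positivity), Real.div_rpow hs.le hx'.le]
    push_cast
    rw [Real.rpow_neg hx'.le]
    congr 1
    ring
  have h1 := congrArg (fun μ => μ (Set.Iic 1)) key
  simp only [Measure.map_apply hm1 measurableSet_Iic, Measure.map_apply hm2 measurableSet_Iic] at h1
  rw [show {ω | L (u * x ^ (-α)) ω ≤ 1} = L (u * x ^ (-α)) ⁻¹' Set.Iic 1 from rfl, ← h1]
  congr 1
  ext ω
  simp only [Set.mem_ofPred_eq, Set.mem_preimage, Set.mem_Iic]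
  rw [inv_mul_le_iff₀ hx, mul_one]

lemma mul_rpow_neg_lt_iff {α : ℝ} {u x y : ℝ≥0} (hx : 0 < x) :
    u * x ^ (-α) < y ↔ u < x ^ α * y := by
  have := NNReal.rpow_pos (p := α) hx
  rw [NNReal.rpow_neg, ← div_eq_mul_inv, div_lt_iff₀ this, mul_comm]

lemma mul_rpow_neg_le_iff {α : ℝ} {u x y : ℝ≥0} (hx : 0 < x) :
    u * x ^ (-α) ≤ y ↔ u ≤ x ^ α * y := by
  have := NNReal.rpow_pos (p := α) hx
  rw [NNReal.rpow_neg, ← div_eq_mul_inv, div_le_iff₀ this, mul_comm]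

lemma meas_lt_scaled_le (hL : IsStableSubordinator α L P) {x : ℝ≥0} (hx : 0 < x) (u : ℝ≥0) :
    P {ω | u < x ^ α * firstPassage L 1 ω} ≤ P {ω | u ≤ firstPassage L x ω} := by
  simp_rw [← mul_rpow_neg_lt_iff hx]
  refine (meas_lt_firstPassage_le L _ _).trans ?_
  rw [← hL.meas_le_scale u hx]
  exact hL.meas_le_meas_le_firstPassage u x

lemma meas_lt_le_scaled (hL : IsStableSubordinator α L P) {x : ℝ≥0} (hx : 0 < x) (u : ℝ≥0) :
    P {ω | u < firstPassage L x ω} ≤ P {ω | u ≤ x ^ α * firstPassage L 1 ω} := by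
  refine (meas_lt_firstPassage_le L _ _).trans ?_
  rw [hL.meas_le_scale u hx]
  refine (hL.meas_le_meas_le_firstPassage _ 1).trans (measure_mono fun ω h => ?_)
  exact (mul_rpow_neg_le_iff hx).1 h

lemma lintegral_firstPassage_scale (hL : IsStableSubordinator α L P) {x : ℝ≥0} (hx : 0 < x) :
    ∫⁻ ω, ENNReal.ofReal (firstPassage L x ω) ∂P =
      ∫⁻ ω, ENNReal.ofReal ((x ^ α * firstPassage L 1 ω : ℝ≥0)) ∂P :=
  le_antisymm
    (lintegral_le_of_meas_lt_le_meas_le (hL.aemeasurable_firstPassage x)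
      ((hL.aemeasurable_firstPassage 1).const_mul _) (hL.meas_lt_le_scaled hx))
    (lintegral_le_of_meas_lt_le_meas_le ((hL.aemeasurable_firstPassage 1).const_mul _)
      (hL.aemeasurable_firstPassage x) (hL.meas_lt_scaled_le hx))

lemma lintegral_sq_firstPassage_scale (hL : IsStableSubordinator α L P) {x : ℝ≥0} (hx : 0 < x) :
    ∫⁻ ω, ENNReal.ofReal ((firstPassage L x ω : ℝ) ^ 2) ∂P =
      ∫⁻ ω, ENNReal.ofReal (((x ^ α * firstPassage L 1 ω : ℝ≥0) : ℝ) ^ 2) ∂P :=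
  le_antisymm
    (lintegral_sq_le_of_meas_lt_le_meas_le (hL.aemeasurable_firstPassage x)
      ((hL.aemeasurable_firstPassage 1).const_mul _) (hL.meas_lt_le_scaled hx))
    (lintegral_sq_le_of_meas_lt_le_meas_le ((hL.aemeasurable_firstPassage 1).const_mul _)
      (hL.aemeasurable_firstPassage x) (hL.meas_lt_scaled_le hx))

/-- A Chernoff bound: `P(L t ≤ 1) ≤ e · E exp (-L t) = e · exp (-t)`. The exponential tail makes all
moments of `Y(1)` that are needed finite. -/
lemma meas_lt_firstPassage_one_le (hL : IsStableSubordinator α L P) {t : ℝ} (ht : 0 ≤ t) :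
    P {ω | t < firstPassage L 1 ω} ≤ ENNReal.ofReal (Real.exp 1 * Real.exp (-t)) := by
  lift t to ℝ≥0 using ht
  have h0 : P {ω | (t : ℝ) < firstPassage L 1 ω} ≤ P {ω | L t ω ≤ 1} := by
    simpa only [NNReal.coe_lt_coe] using meas_lt_firstPassage_le L t 1
  refine h0.trans ?_
  have h1 := mul_meas_ge_le_integral_of_nonneg (μ := P)
    (f := fun ω => Real.exp (-1 * (L t ω : ℝ))) (.of_forall fun ω => (Real.exp_pos _).le)
    (Integrable.of_bound (by
      have := hL.subordinator.measurable t
      exact Measurable.aestronglyMeasurable (by fun_prop)) 1 (.of_forall fun ω => by simp))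
    (Real.exp (-1))
  rw [hL.laplace t 1 one_pos] at h1
  have h2 : {ω | Real.exp (-1) ≤ Real.exp (-1 * (L t ω : ℝ))} = {ω | L t ω ≤ 1} := by
    ext ω
    rw [Set.mem_ofPred_eq, Set.mem_ofPred_eq, Real.exp_le_exp, ← NNReal.coe_le_coe, NNReal.coe_one]
    constructor <;> intro h <;> linarith
  rw [h2] at h1
  rw [← ofReal_measureReal]
  refine ENNReal.ofReal_le_ofReal ?_
  rw [Real.exp_neg 1, inv_mul_le_iff₀ (Real.exp_pos _)] at h1
  simpa using h1

lemma lintegral_sq_firstPassage_one_lt_top (hL : IsStableSubordinator α L P) :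
    ∫⁻ ω, ENNReal.ofReal ((firstPassage L 1 ω : ℝ) ^ 2) ∂P < ∞ := by
  have h1 := lintegral_rpow_eq_lintegral_meas_lt_mul P
    (f := fun ω => (firstPassage L 1 ω : ℝ)) (.of_forall fun _ => by simp)
    (hL.aemeasurable_firstPassage 1).coe_nnreal_real (p := 2) two_pos
  simp only [Real.rpow_ofNat] at h1
  rw [h1]
  refine ENNReal.mul_lt_top (by simp) ?_
  have h2 : IntegrableOn (fun t : ℝ => Real.exp 1 * (Real.exp (-t) * t ^ ((2 : ℝ) - 1)))
      (Set.Ioi 0) :=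
    (Real.GammaIntegral_convergent two_pos).const_mul _
  refine lt_of_le_of_lt ?_ h2.lintegral_lt_top
  refine setLIntegral_mono' measurableSet_Ioi fun t ht => ?_
  rw [← mul_assoc, ENNReal.ofReal_mul (by positivity)]
  gcongr
  exact hL.meas_lt_firstPassage_one_le (le_of_lt ht)

end IsStableSubordinator

end InverseStable

lemma memLp_two_of_lintegral_sq_lt_top {Ω : Type*} [MeasurableSpace Ω] {P : Measure Ω}
    {f : Ω → ℝ} (hf : AEMeasurable f P) (h : ∫⁻ ω, ENNReal.ofReal (f ω ^ 2) ∂P < ∞) :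
    MemLp f 2 P := by
  rw [memLp_two_iff_integrable_sq hf.aestronglyMeasurable]
  refine ⟨(hf.pow_const 2).aestronglyMeasurable, ?_⟩
  rw [hasFiniteIntegral_iff_ofReal (.of_forall fun _ => sq_nonneg _)]
  exact h

section InverseStable

variable {Ω : Type*} [MeasurableSpace Ω] {P : Measure Ω} [IsProbabilityMeasure P]
  {α : ℝ} {L : ℝ≥0 → Ω → ℝ≥0}

namespace IsStableSubordinator

lemma memLp_firstPassage (hL : IsStableSubordinator α L P) (x : ℝ≥0) :
    MemLp (fun ω => (firstPassage L x ω : ℝ)) 2 P := by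
  have hpos : ∀ x : ℝ≥0, 0 < x → MemLp (fun ω => (firstPassage L x ω : ℝ)) 2 P := fun x hx => by
    refine memLp_two_of_lintegral_sq_lt_top (hL.aemeasurable_firstPassage x).coe_nnreal_real ?_
    rw [hL.lintegral_sq_firstPassage_scale hx]
    simp_rw [NNReal.coe_mul, mul_pow]
    simp_rw [ENNReal.ofReal_mul (sq_nonneg ((x ^ α : ℝ≥0) : ℝ))]
    rw [lintegral_const_mul' _ _ ENNReal.ofReal_ne_top]
    exact ENNReal.mul_lt_top ENNReal.ofReal_lt_top hL.lintegral_sq_firstPassage_one_lt_top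
  rcases eq_or_ne x 0 with rfl | hx
  · refine (hpos 1 one_pos).mono
      (hL.aemeasurable_firstPassage 0).coe_nnreal_real.aestronglyMeasurable ?_
    filter_upwards [hL.ae_firstPassage_mono] with ω hω
    simpa using hω (zero_le_one (α := ℝ≥0))
  · exact hpos x (pos_iff_ne_zero.2 hx)

lemma integrable_firstPassage (hL : IsStableSubordinator α L P) (x : ℝ≥0) :
    Integrable (fun ω => (firstPassage L x ω : ℝ)) P :=
  (hL.memLp_firstPassage x).integrable one_le_two

lemma integrable_firstPassage_mul (hL : IsStableSubordinator α L P) (x y : ℝ≥0) :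
    Integrable (fun ω => (firstPassage L x ω : ℝ) * firstPassage L y ω) P :=
  (hL.memLp_firstPassage x).integrable_mul (hL.memLp_firstPassage y)

lemma integral_firstPassage_of_pos (hL : IsStableSubordinator α L P) {x : ℝ≥0} (hx : 0 < x) :
    ∫ ω, (firstPassage L x ω : ℝ) ∂P = (x : ℝ) ^ α * ∫ ω, (firstPassage L 1 ω : ℝ) ∂P := by
  rw [← integral_const_mul, integral_eq_lintegral_of_nonneg_ae (.of_forall fun _ => by simp)
    (hL.integrable_firstPassage x).1, hL.lintegral_firstPassage_scale hx,
    integral_eq_lintegral_of_nonneg_ae (.of_forall fun _ => by positivity)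
    ((hL.integrable_firstPassage 1).1.const_mul _)]
  simp

/-- By monotonicity `E Y(0) ≤ E Y(x) = c x^α`, which tends to zero with `x`. -/
lemma ae_firstPassage_zero (hα₀ : 0 < α) (hL : IsStableSubordinator α L P) :
    ∀ᵐ ω ∂P, firstPassage L 0 ω = 0 := by
  have h1 : ∫ ω, (firstPassage L 0 ω : ℝ) ∂P ≤ 0 := by
    have h2 : Tendsto (fun x : ℝ≥0 => (x : ℝ) ^ α * ∫ ω, (firstPassage L 1 ω : ℝ) ∂P) (𝓝[>] 0)
        (𝓝 0) := by
      have : Tendsto (fun x : ℝ≥0 => (x : ℝ) ^ α) (𝓝 0) (𝓝 (((0 : ℝ≥0) : ℝ) ^ α)) :=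
        ((Real.continuousAt_rpow_const _ _ (Or.inr hα₀.le)).comp
          NNReal.continuous_coe.continuousAt).tendsto
      rw [NNReal.coe_zero, Real.zero_rpow hα₀.ne'] at this
      simpa using (this.mono_left nhdsWithin_le_nhds).mul_const (∫ ω, (firstPassage L 1 ω : ℝ) ∂P)
    refine ge_of_tendsto h2 ?_
    filter_upwards [self_mem_nhdsWithin] with x hx
    rw [← hL.integral_firstPassage_of_pos hx]
    refine integral_mono_ae (hL.integrable_firstPassage _) (hL.integrable_firstPassage _) ?_
    filter_upwards [hL.ae_firstPassage_mono] with ω hω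
    exact_mod_cast hω (le_of_lt hx)
  have h3 := (integral_eq_zero_iff_of_nonneg (fun ω => by simp)
    (hL.integrable_firstPassage 0)).1 (le_antisymm h1 (integral_nonneg fun ω => by simp))
  filter_upwards [h3] with ω hω
  simpa using hω

lemma integral_firstPassage (hα₀ : 0 < α) (hL : IsStableSubordinator α L P) (x : ℝ≥0) :
    ∫ ω, (firstPassage L x ω : ℝ) ∂P = (x : ℝ) ^ α * ∫ ω, (firstPassage L 1 ω : ℝ) ∂P := by
  rcases eq_or_ne x 0 with rfl | hx
  · rw [NNReal.coe_zero, Real.zero_rpow hα₀.ne', zero_mul]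
    refine integral_eq_zero_of_ae ?_
    filter_upwards [hL.ae_firstPassage_zero hα₀] with ω hω
    simp [hω]
  · exact hL.integral_firstPassage_of_pos (pos_iff_ne_zero.2 hx)

lemma integral_sq_firstPassage (hα₀ : 0 < α) (hL : IsStableSubordinator α L P) (x : ℝ≥0) :
    ∫ ω, (firstPassage L x ω : ℝ) ^ 2 ∂P =
      (x : ℝ) ^ (2 * α) * ∫ ω, (firstPassage L 1 ω : ℝ) ^ 2 ∂P := by
  rcases eq_or_ne x 0 with rfl | hx
  · rw [NNReal.coe_zero, Real.zero_rpow (by positivity), zero_mul]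
    refine integral_eq_zero_of_ae ?_
    filter_upwards [hL.ae_firstPassage_zero hα₀] with ω hω
    simp [hω]
  · have e : (x : ℝ) ^ (2 * α) = ((x : ℝ) ^ α) ^ 2 := by
      rw [← Real.rpow_mul_natCast (by simp), mul_comm]; norm_num
    rw [e, ← integral_const_mul, integral_eq_lintegral_of_nonneg_ae
      (.of_forall fun _ => by positivity)
      (hL.memLp_firstPassage x).integrable_sq.1,
      hL.lintegral_sq_firstPassage_scale (pos_iff_ne_zero.2 hx),
      integral_eq_lintegral_of_nonneg_ae (.of_forall fun _ => by positivity)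
      ((hL.memLp_firstPassage 1).integrable_sq.1.const_mul _)]
    simp [mul_pow]

/-- If `Y(1)` vanished almost surely, `L (1/2)` would exceed `1` almost surely, giving `E exp (-L
(1/2)) ≤ exp (-1)`. But that expectation is `exp (-1/2)`. -/
lemma integral_firstPassage_one_pos (hL : IsStableSubordinator α L P) :
    0 < ∫ ω, (firstPassage L 1 ω : ℝ) ∂P := by
  refine lt_of_le_of_ne (integral_nonneg fun ω => by simp) fun h0 => ?_
  have h1 := (integral_eq_zero_iff_of_nonneg (fun ω => by simp)
    (hL.integrable_firstPassage 1)).1 h0.symm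
  have h2 : P {ω | L (1 / 2) ω ≤ 1} = 0 := by
    refine le_antisymm ((hL.meas_le_meas_le_firstPassage _ _).trans ?_) bot_le
    refine le_of_eq (measure_eq_zero_iff_ae_notMem.2 ?_)
    filter_upwards [h1] with ω hω
    have : firstPassage L 1 ω = 0 := by simpa using hω
    simp [this]
  have h3 := hL.laplace (1 / 2) 1 one_pos
  have hint : Integrable (fun ω => Real.exp (-1 * (L (1 / 2) ω : ℝ))) P :=
    Integrable.of_bound (by
      have := hL.subordinator.measurable (1 / 2)
      exact Measurable.aestronglyMeasurable (by fun_prop)) 1 (.of_forall fun ω => by simp)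
  have h4 : ∫ ω, Real.exp (-1 * (L (1 / 2) ω : ℝ)) ∂P ≤ ∫ _, Real.exp (-1) ∂P := by
    refine integral_mono_ae hint (integrable_const _) ?_
    filter_upwards [measure_eq_zero_iff_ae_notMem.1 h2] with ω hω
    have : (1 : ℝ) < L (1 / 2) ω := by exact_mod_cast not_le.1 hω
    exact Real.exp_le_exp.2 (by linarith)
  rw [h3] at h4
  simp only [integral_const, probReal_univ, one_smul, Real.exp_le_exp] at h4
  norm_num at h4

/-- Suppose `Y(1)` is a constant `c`. Then `L` stays at most `1` before time `c` and exceeds `1`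
after it. For `α < 1`, scaling bounds `L` by `1/2` up to a time longer than `c/2`; two such
stretches keep `L` at most `1` past `c`, a contradiction. -/
lemma sq_integral_firstPassage_one_lt (hL : IsStableSubordinator α L P) (hα₁ : α < 1) :
    (∫ ω, (firstPassage L 1 ω : ℝ) ∂P) ^ 2 < ∫ ω, (firstPassage L 1 ω : ℝ) ^ 2 ∂P := by
  have hvar := variance_eq_sub (hL.memLp_firstPassage 1)
  simp only [Pi.pow_apply] at hvar
  suffices h : Var[fun ω => (firstPassage L 1 ω : ℝ); P] ≠ 0 by
    have := lt_of_le_of_ne (variance_nonneg _ P) h.symm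
    linarith
  intro h0
  have hc := hL.integral_firstPassage_one_pos
  have h1 := ae_eq_integral_of_variance_eq_zero (hL.memLp_firstPassage 1) h0
  generalize hcdef : ∫ ω, (firstPassage L 1 ω : ℝ) ∂P = c at hc h1
  lift c to ℝ≥0 using hc.le
  have hc' : 0 < c := hc
  have hconst : ∀ᵐ ω ∂P, firstPassage L 1 ω = c := by
    filter_upwards [h1] with ω hω
    exact_mod_cast hω
  have hlow : ∀ u < c, ∀ᵐ ω ∂P, L u ω ≤ 1 := fun u hu => by
    filter_upwards [hconst] with ω hω
    exact apply_le_of_lt_firstPassage (hω ▸ hu)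
  -- an intermediate time `u > c` with `u * 2 ^ (α - 1) < c`
  set r : ℝ≥0 := 2 ^ ((1 - α) / 2) with hr
  have hr1 : 1 < r := NNReal.one_lt_rpow one_lt_two (by linarith)
  have hu : c < c * r := lt_mul_of_one_lt_right hc' hr1
  -- By scaling, the event `L (c r / 2) ≤ 1/2` has the probability of `L (c r 2^(α-1)) ≤ 1`, and `r
  -- 2^(α-1) = 2^((α-1)/2) < 1`.
  have hhalf : ∀ᵐ ω ∂P, L (c * r / 2) ω ≤ 1 / 2 := by
    have h2 := hL.meas_le_scale (c * r / 2) (x := 1 / 2) (by positivity)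
    have h3 : c * r / 2 * (1 / 2) ^ (-α) < c := by
      have : r * (2⁻¹ * (1 / 2) ^ (-α)) < 1 := by
        have e1 : (2⁻¹ : ℝ≥0) = 2 ^ (-1 : ℝ) := by rw [NNReal.rpow_neg_one]
        rw [one_div, NNReal.rpow_neg, NNReal.inv_rpow, inv_inv, hr, e1,
          ← NNReal.rpow_add two_ne_zero, ← NNReal.rpow_add two_ne_zero]
        exact NNReal.rpow_lt_one_of_one_lt_of_neg one_lt_two (by linarith)
      calc c * r / 2 * (1 / 2) ^ (-α) = c * (r * (2⁻¹ * (1 / 2) ^ (-α))) := by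
            rw [div_eq_mul_inv]; ring
        _ < c * 1 := by gcongr
        _ = c := mul_one c
    rw [measure_congr (show {ω | L (c * r / 2 * (1 / 2) ^ (-α)) ω ≤ 1} =ᵐ[P] Set.univ from
      eventuallyEq_univ.2 (hlow _ h3)), measure_univ] at h2
    have hms : MeasurableSet {ω | L (c * r / 2) ω ≤ 1 / 2} :=
      measurableSet_le (hL.subordinator.measurable _) measurable_const
    exact (mem_ae_iff_prob_eq_one hms).2 h2
  have hlevy := hL.subordinator.levy
  -- The second stretch has the law of the first, so stationarity alone gives the almost sure bound.
  have hincr : ∀ᵐ ω ∂P, (L (c * r / 2 + c * r / 2) ω : ℝ) - L (c * r / 2) ω ≤ 1 / 2 := by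
    have h4 := hlevy.stationary (c * r / 2) (c * r / 2)
    refine h4.symm.ae_snd (p := fun z : ℝ => z ≤ 1 / 2) measurableSet_Iic ?_
    filter_upwards [hhalf] with ω hω
    exact_mod_cast hω
  have h5 : P {ω | L (c * r) ω ≤ 1} = 0 := by
    refine le_antisymm ((hL.meas_le_meas_le_firstPassage _ _).trans ?_) bot_le
    refine le_of_eq (measure_eq_zero_iff_ae_notMem.2 ?_)
    filter_upwards [hconst] with ω hω
    simpa [hω] using hu
  have h6 : ∀ᵐ ω ∂P, False := by
    filter_upwards [measure_eq_zero_iff_ae_notMem.1 h5, hhalf, hincr] with ω h7 h8 h9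
    rw [add_halves] at h9
    refine h7 ?_
    have h8' : (L (c * r / 2) ω : ℝ) ≤ 1 / 2 := by exact_mod_cast h8
    rw [← NNReal.coe_le_coe, NNReal.coe_one]
    linarith
  exact h6.exists.choose_spec

omit [IsProbabilityMeasure P] in
/-- Independence and stationarity of the increments of the stable subordinator. -/
lemma meas_le_and_increment_le (hL : IsStableSubordinator α L P) (u w : ℝ≥0) (x z : ℝ≥0) :
    P {ω | L u ω ≤ x ∧ (L (u + w) ω : ℝ) - L u ω ≤ z} =
      P {ω | L u ω ≤ x} * P {ω | L w ω ≤ z} := by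
  have hlevy := hL.subordinator.levy
  have h1 := hlevy.indep.indepFun_eval_sub (s := u) (t := u + w) zero_le
    (le_add_of_nonneg_right zero_le) hlevy.zero
  have h2 := h1.measure_inter_preimage_eq_mul (Set.Iic (x : ℝ)) (Set.Iic (z : ℝ))
    measurableSet_Iic measurableSet_Iic
  have h3 : P ((fun ω => (L (u + w) ω : ℝ) - L u ω) ⁻¹' Set.Iic (z : ℝ)) =
      P {ω | L w ω ≤ z} := by
    rw [(hlevy.stationary u w).measure_mem_eq measurableSet_Iic]
    congr 1
  have h4 : (fun ω => (L u ω : ℝ)) ⁻¹' Set.Iic (x : ℝ) = {ω | L u ω ≤ x} := by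
    ext ω
    simp
  rw [h4] at h2
  rw [← h3]
  exact h2

/-- On `{u < Y(x), u + w < Y(y)}` one has `L u ≤ x` and, dropping `L u` from `L (u + w) ≤ y`, an
increment of at most `y`. The two events are independent, and integrating the product of their
probabilities over `u` and `w` gives the product of the means. -/
lemma lintegral_firstPassage_mul_le (hL : IsStableSubordinator α L P) {x y : ℝ≥0} (hxy : x ≤ y) :
    ∫⁻ ω, ENNReal.ofReal ((firstPassage L x ω : ℝ) * firstPassage L y ω -
        (firstPassage L x ω : ℝ) ^ 2 / 2) ∂P ≤
      (∫⁻ ω, ENNReal.ofReal (firstPassage L x ω) ∂P) *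
        ∫⁻ ω, ENNReal.ofReal (firstPassage L y ω) ∂P := by
  have hx := hL.aemeasurable_firstPassage x
  have hy := hL.aemeasurable_firstPassage y
  have hfin : ∫⁻ ω, ENNReal.ofReal (firstPassage L y ω) ∂P ≠ ∞ :=
    (hL.integrable_firstPassage y).lintegral_lt_top.ne
  rw [lintegral_mul_sub_sq_half_lt hx hy (hL.ae_firstPassage_mono.mono fun ω h => h hxy)]
  rw [lintegral_eq_lintegral_meas_le P (f := fun ω => (firstPassage L y ω : ℝ))
    (.of_forall fun _ => by simp) hy.coe_nnreal_real] at hfin ⊢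
  rw [lintegral_eq_lintegral_meas_le P (f := fun ω => (firstPassage L x ω : ℝ))
    (.of_forall fun _ => by simp) hx.coe_nnreal_real, ← lintegral_mul_const' _ _ hfin]
  refine setLIntegral_mono' measurableSet_Ioi fun u hu => ?_
  rw [← lintegral_const_mul' _ _ (measure_ne_top _ _)]
  refine setLIntegral_mono' measurableSet_Ioi fun w hw => ?_
  lift u to ℝ≥0 using le_of_lt hu
  lift w to ℝ≥0 using le_of_lt hw
  simp only [← NNReal.coe_add, NNReal.coe_lt_coe, NNReal.coe_le_coe]
  calc P {ω | u < firstPassage L x ω ∧ u + w < firstPassage L y ω}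
      ≤ P {ω | L u ω ≤ x ∧ (L (u + w) ω : ℝ) - L u ω ≤ y} := by
        refine measure_mono fun ω hω => ⟨apply_le_of_lt_firstPassage hω.1, ?_⟩
        have h1 : (L (u + w) ω : ℝ) ≤ y := by exact_mod_cast apply_le_of_lt_firstPassage hω.2
        have h2 := (L u ω).coe_nonneg
        linarith
    _ = P {ω | L u ω ≤ x} * P {ω | L w ω ≤ y} := hL.meas_le_and_increment_le u w x y
    _ ≤ _ := mul_le_mul' (hL.meas_le_meas_le_firstPassage u x) (hL.meas_le_meas_le_firstPassage w y)

/-- Conversely, `L u ≤ x` together with an increment of at most `d` forces `L (u + w) ≤ x + d`. The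
loss against the upper bound is only the replacement of `x + d` by `d`. -/
lemma le_lintegral_firstPassage_mul (hL : IsStableSubordinator α L P) (x d : ℝ≥0) :
    (∫⁻ ω, ENNReal.ofReal (firstPassage L x ω) ∂P) *
        ∫⁻ ω, ENNReal.ofReal (firstPassage L d ω) ∂P ≤
    ∫⁻ ω, ENNReal.ofReal ((firstPassage L x ω : ℝ) * firstPassage L (x + d) ω -
        (firstPassage L x ω : ℝ) ^ 2 / 2) ∂P := by
  have hx := hL.aemeasurable_firstPassage x
  have hy := hL.aemeasurable_firstPassage d
  have hfin : ∫⁻ ω, ENNReal.ofReal (firstPassage L d ω) ∂P ≠ ∞ :=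
    (hL.integrable_firstPassage d).lintegral_lt_top.ne
  rw [lintegral_mul_sub_sq_half_le hx (hL.aemeasurable_firstPassage (x + d))
    (hL.ae_firstPassage_mono.mono fun ω h => h (le_add_of_nonneg_right zero_le))]
  rw [lintegral_eq_lintegral_meas_lt P (f := fun ω => (firstPassage L d ω : ℝ))
    (.of_forall fun _ => by simp) hy.coe_nnreal_real] at hfin ⊢
  rw [lintegral_eq_lintegral_meas_lt P (f := fun ω => (firstPassage L x ω : ℝ))
    (.of_forall fun _ => by simp) hx.coe_nnreal_real, ← lintegral_mul_const' _ _ hfin]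
  refine setLIntegral_mono' measurableSet_Ioi fun u hu => ?_
  rw [← lintegral_const_mul' _ _ (measure_ne_top _ _)]
  refine setLIntegral_mono' measurableSet_Ioi fun w hw => ?_
  lift u to ℝ≥0 using le_of_lt hu
  lift w to ℝ≥0 using le_of_lt hw
  simp only [← NNReal.coe_add, NNReal.coe_lt_coe, NNReal.coe_le_coe]
  calc _ ≤ P {ω | L u ω ≤ x} * P {ω | L w ω ≤ d} :=
        mul_le_mul' (meas_lt_firstPassage_le L u x) (meas_lt_firstPassage_le L w d)
    _ = P {ω | L u ω ≤ x ∧ (L (u + w) ω : ℝ) - L u ω ≤ d} :=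
        (hL.meas_le_and_increment_le u w x d).symm
    _ ≤ _ := by
        refine measure_mono_ae ?_
        filter_upwards [hL.tendsto_atTop, hL.subordinator.monotone] with ω h1 h2 h
        refine ⟨le_firstPassage_of_apply_le h2 h1 h.1, le_firstPassage_of_apply_le h2 h1 ?_⟩
        have h3 : (L u ω : ℝ) ≤ x := by exact_mod_cast h.1
        have h4 := h.2
        rw [← NNReal.coe_le_coe, NNReal.coe_add]
        linarith

lemma lintegral_firstPassage_mul_eq (hL : IsStableSubordinator α L P) {x y : ℝ≥0} (hxy : x ≤ y) :
    ∫⁻ ω, ENNReal.ofReal ((firstPassage L x ω : ℝ) * firstPassage L y ω -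
        (firstPassage L x ω : ℝ) ^ 2 / 2) ∂P =
    ENNReal.ofReal (∫ ω, (firstPassage L x ω : ℝ) * firstPassage L y ω ∂P -
      (∫ ω, (firstPassage L x ω : ℝ) ^ 2 ∂P) / 2) ∧
    0 ≤ ∫ ω, (firstPassage L x ω : ℝ) * firstPassage L y ω ∂P -
      (∫ ω, (firstPassage L x ω : ℝ) ^ 2 ∂P) / 2 := by
  have h1 := hL.integrable_firstPassage_mul x y
  have h2 := (hL.memLp_firstPassage x).integrable_sq.div_const 2
  have h3 : 0 ≤ᵐ[P] fun ω => (firstPassage L x ω : ℝ) * firstPassage L y ω -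
      (firstPassage L x ω : ℝ) ^ 2 / 2 := by
    filter_upwards [hL.ae_firstPassage_mono] with ω hω
    have h4 : (firstPassage L x ω : ℝ) ≤ firstPassage L y ω := by exact_mod_cast hω hxy
    have h5 := (firstPassage L x ω).coe_nonneg
    simp only [Pi.zero_apply]
    nlinarith
  rw [← integral_div, ← integral_sub h1 h2]
  exact ⟨(ofReal_integral_eq_lintegral_ofReal (h1.sub h2) h3).symm, integral_nonneg_of_ae h3⟩

/-- Two-sided bounds for the second moments of the inverse stable subordinator at two times. -/
theorem integral_firstPassage_mul_bounds (hα₀ : 0 < α) (hL : IsStableSubordinator α L P)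
    (x d : ℝ≥0) :
    (∫ ω, (firstPassage L 1 ω : ℝ) ^ 2 ∂P) / 2 * (x : ℝ) ^ (2 * α) +
        (∫ ω, (firstPassage L 1 ω : ℝ) ∂P) ^ 2 * ((x : ℝ) ^ α * (d : ℝ) ^ α) ≤
      ∫ ω, (firstPassage L x ω : ℝ) * firstPassage L (x + d) ω ∂P ∧
    ∫ ω, (firstPassage L x ω : ℝ) * firstPassage L (x + d) ω ∂P ≤
      (∫ ω, (firstPassage L 1 ω : ℝ) ^ 2 ∂P) / 2 * (x : ℝ) ^ (2 * α) +
        (∫ ω, (firstPassage L 1 ω : ℝ) ∂P) ^ 2 *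
          ((x : ℝ) ^ α * ((x + d : ℝ≥0) : ℝ) ^ α) := by
  have hxy : x ≤ x + d := le_add_of_nonneg_right zero_le
  have hlow := hL.le_lintegral_firstPassage_mul x d
  have hup := hL.lintegral_firstPassage_mul_le hxy
  obtain ⟨e, he⟩ := hL.lintegral_firstPassage_mul_eq hxy
  have h1 : ∀ x, ∫⁻ ω, ENNReal.ofReal (firstPassage L x ω) ∂P =
      ENNReal.ofReal ((x : ℝ) ^ α * ∫ ω, (firstPassage L 1 ω : ℝ) ∂P) := fun x => by
    rw [← hL.integral_firstPassage hα₀, ofReal_integral_eq_lintegral_ofReal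
      (hL.integrable_firstPassage x) (.of_forall fun _ => by simp)]
  have hc : 0 ≤ ∫ ω, (firstPassage L 1 ω : ℝ) ∂P := integral_nonneg fun ω => by simp
  have hn : ∀ x : ℝ≥0, 0 ≤ (x : ℝ) ^ α * ∫ ω, (firstPassage L 1 ω : ℝ) ∂P := fun x => by
    positivity
  rw [e, h1, h1, ← ENNReal.ofReal_mul (hn _), hL.integral_sq_firstPassage hα₀] at hlow hup
  rw [hL.integral_sq_firstPassage hα₀] at he
  rw [ENNReal.ofReal_le_ofReal_iff he] at hlow
  rw [ENNReal.ofReal_le_ofReal_iff (mul_nonneg (hn _) (hn _))] at hup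
  constructor <;> linarith

end IsStableSubordinator

end InverseStable

/-! ### Laplace transforms of Lévy processes -/

section Levy

variable {Ω : Type*} [MeasurableSpace Ω] {P : Measure Ω} {X : ℝ≥0 → Ω → ℝ}

lemma IsLevyProcess.indepFun_increment (hX : IsLevyProcess X P) {s t : ℝ≥0}
    (hst : s ≤ t) : IndepFun (X s) (X t - X s) P :=
  hX.indep.indepFun_eval_sub zero_le hst hX.zero

lemma IsLevyProcess.laplace_add (hX : IsLevyProcess X P) (a b : ℝ≥0) (θ : ℝ) :
    ∫ ω, Real.exp (-θ * X (a + b) ω) ∂P =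
      (∫ ω, Real.exp (-θ * X a ω) ∂P) * ∫ ω, Real.exp (-θ * X b ω) ∂P := by
  have hexp : Measurable (fun x : ℝ => Real.exp (-θ * x)) := by fun_prop
  have h1 := (hX.indepFun_increment (s := a) (t := a + b) (le_add_of_nonneg_right zero_le)).comp
    hexp hexp
  have h2 := ((hX.stationary a b).comp hexp).integral_eq
  have hma := hX.measurable a
  have hmb := hX.measurable (a + b)
  have h3 := h1.integral_mul_eq_mul_integral (hexp.comp hma).aestronglyMeasurable
    (hexp.comp (hmb.sub hma)).aestronglyMeasurable
  simp only [Function.comp_def] at h2 h3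
  rw [← h2]
  refine Eq.trans ?_ h3
  refine integral_congr_ae (.of_forall fun ω => ?_)
  simp only [Pi.mul_apply, Pi.sub_apply, ← Real.exp_add]
  ring_nf

lemma IsLevyProcess.laplace_nsmul [IsProbabilityMeasure P] (hX : IsLevyProcess X P) (n : ℕ)
    (a : ℝ≥0) (θ : ℝ) :
    ∫ ω, Real.exp (-θ * X (n * a) ω) ∂P = (∫ ω, Real.exp (-θ * X a ω) ∂P) ^ n := by
  induction n with
  | zero =>
    have : ∀ᵐ ω ∂P, Real.exp (-θ * X ((0 : ℕ) * a) ω) = 1 := by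
      filter_upwards [hX.zero] with ω hω
      simp [hω]
    rw [integral_congr_ae this]
    simp
  | succ n ih =>
    rw [Nat.cast_succ, add_mul, one_mul, hX.laplace_add, ih, pow_succ]

end Levy

/-! ### Laplace transform of the generalized counting process -/

section CountingProcess

variable {Ω : Type*} [MeasurableSpace Ω] {P : Measure Ω} [IsProbabilityMeasure P]
  {k : ℕ} {rate : ℕ → ℝ} {M : ℝ≥0 → Ω → ℕ}

/-- The exponent of the Laplace transform of the generalized counting process. -/
noncomputable def laplaceExponent (k : ℕ) (rate : ℕ → ℝ) (θ : ℝ) : ℝ :=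
  ∑ j ∈ Finset.Icc 1 k, rate j * (Real.exp (-θ * j) - 1)

namespace IsGeneralizedCountingProcess

omit [IsProbabilityMeasure P] in
lemma measurable (hM : IsGeneralizedCountingProcess k rate M P) (t : ℝ≥0) : Measurable (M t) := by
  refine measurable_to_countable' fun n => ?_
  have := hM.levy.measurable t (measurableSet_singleton (n : ℝ))
  convert this using 1
  ext ω
  simp

lemma integrable_exp (hM : IsGeneralizedCountingProcess k rate M P) (t : ℝ≥0) {θ : ℝ}
    (hθ : 0 ≤ θ) : Integrable (fun ω => Real.exp (-θ * M t ω)) P :=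
  Integrable.of_bound (by
    have := hM.levy.measurable t
    exact Measurable.aestronglyMeasurable (by fun_prop)) 1 (.of_forall fun ω => by
      rw [Real.norm_of_nonneg (Real.exp_pos _).le]
      exact Real.exp_le_one_iff.2 (by
        have : (0 : ℝ) ≤ M t ω := by positivity
        nlinarith))

/-- Since `M 0 = 0` almost surely, conditioning on it changes nothing, so the transition rates from
time `0` and state `0` become unconditional rates. -/
lemma cond_start (hM : IsGeneralizedCountingProcess k rate M P) :
    P (M 0 ⁻¹' {0}) ≠ 0 ∧ ∀ s : Set Ω,
      (ProbabilityTheory.cond P (M 0 ⁻¹' {0})).real s = P.real s := by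
  have h1 : P (M 0 ⁻¹' {0}) = 1 := by
    rw [← mem_ae_iff_prob_eq_one (hM.measurable 0 (measurableSet_singleton 0))]
    filter_upwards [hM.levy.zero] with ω hω
    simpa using hω
  refine ⟨by simp [h1], fun s => ?_⟩
  rw [measureReal_def, measureReal_def, cond_apply (hM.measurable 0 (measurableSet_singleton 0)),
    h1, inv_one, one_mul]
  congr 1
  refine measure_congr ?_
  filter_upwards [hM.levy.zero] with ω hω
  have h0 : M 0 ω = 0 := by exact_mod_cast hω
  exact propext ⟨fun h => h.2, fun h => ⟨h0, h⟩⟩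

lemma isLittleO_stay (hM : IsGeneralizedCountingProcess k rate M P) :
    (fun h : ℝ≥0 => P.real (M h ⁻¹' {0}) - (1 - (∑ j ∈ Finset.Icc 1 k, rate j) * (h : ℝ)))
      =o[𝓝[>] 0] (fun h : ℝ≥0 => (h : ℝ)) := by
  have h := hM.stay 0 0 hM.cond_start.1
  simpa only [hM.cond_start.2, zero_add] using h

lemma isLittleO_jump (hM : IsGeneralizedCountingProcess k rate M P) {j : ℕ}
    (hj : j ∈ Finset.Icc 1 k) :
    (fun h : ℝ≥0 => P.real (M h ⁻¹' {j}) - rate j * (h : ℝ))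
      =o[𝓝[>] 0] (fun h : ℝ≥0 => (h : ℝ)) := by
  have h := hM.jump 0 0 hM.cond_start.1 j hj
  simpa only [hM.cond_start.2, zero_add] using h

lemma exp_neg_mul_nat_eq (k : ℕ) (θ : ℝ) (m : ℕ) :
    Real.exp (-θ * m) = ({0} : Set ℕ).indicator 1 m +
      ∑ j ∈ Finset.Icc 1 k, Real.exp (-θ * j) * ({j} : Set ℕ).indicator 1 m +
      Real.exp (-θ * m) * (Set.Ioi k).indicator 1 m := by
  classical
  simp only [Set.indicator_apply, Set.mem_singleton_iff, Pi.one_apply, mul_ite, mul_one, mul_zero,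
    Finset.sum_ite_eq, Finset.mem_Icc, Set.mem_Ioi]
  rcases Nat.eq_zero_or_pos m with rfl | hm
  · simp
  · by_cases hk : m ≤ k
    · simp [hm.ne', hk, Nat.succ_le_of_lt hm]
    · simp [hm.ne', hk, not_le.1 hk]

/-- `R` is the contribution of values above `k`. The clause for `θ = 0` recovers conservation of
total mass, from which the tail probability is read off. -/
lemma integral_exp_eq (hM : IsGeneralizedCountingProcess k rate M P) (h : ℝ≥0) {θ : ℝ}
    (hθ : 0 ≤ θ) :
    ∃ R, 0 ≤ R ∧ R ≤ P.real (M h ⁻¹' Set.Ioi k) ∧ (θ = 0 → R = P.real (M h ⁻¹' Set.Ioi k)) ∧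
      ∫ ω, Real.exp (-θ * M h ω) ∂P = P.real (M h ⁻¹' {0}) +
        ∑ j ∈ Finset.Icc 1 k, Real.exp (-θ * j) * P.real (M h ⁻¹' {j}) + R := by
  have hms : ∀ s : Set ℕ, MeasurableSet (M h ⁻¹' s) := fun s => hM.measurable h .of_discrete
  have hint : ∀ s : Set ℕ, Integrable (fun ω => (s.indicator 1 (M h ω) : ℝ)) P := fun s =>
    (integrable_const (1 : ℝ)).indicator (hms s)
  have hval : ∀ s : Set ℕ, ∫ ω, (s.indicator 1 (M h ω) : ℝ) ∂P = P.real (M h ⁻¹' s) := fun s =>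
    integral_indicator_one (hms s)
  have hle : ∀ ω, Real.exp (-θ * M h ω) * (Set.Ioi k).indicator 1 (M h ω) ≤
      (Set.Ioi k).indicator 1 (M h ω) := fun ω => by
    refine mul_le_of_le_one_left (Set.indicator_nonneg (fun _ _ => zero_le_one) _) ?_
    exact Real.exp_le_one_iff.2 (by
        have : (0 : ℝ) ≤ M h ω := by positivity
        nlinarith)
  have hnn : ∀ ω, 0 ≤ Real.exp (-θ * M h ω) * (Set.Ioi k).indicator 1 (M h ω) := fun ω =>
    mul_nonneg (Real.exp_pos _).le (Set.indicator_nonneg (fun _ _ => zero_le_one) _)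
  have hintR : Integrable (fun ω => Real.exp (-θ * M h ω) *
      (Set.Ioi k).indicator 1 (M h ω)) P := by
    refine (hint (Set.Ioi k)).mono' ((hM.integrable_exp h hθ).1.mul (hint _).1) ?_
    refine .of_forall fun ω => ?_
    rw [Real.norm_of_nonneg (hnn ω)]
    exact hle ω
  have hintS : Integrable (fun ω => ∑ j ∈ Finset.Icc 1 k,
      Real.exp (-θ * j) * (({j} : Set ℕ).indicator 1 (M h ω) : ℝ)) P :=
    integrable_finsetSum _ fun j _ => (hint _).const_mul _
  have hintS' : Integrable (fun ω => (({0} : Set ℕ).indicator 1 (M h ω) : ℝ) +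
      ∑ j ∈ Finset.Icc 1 k, Real.exp (-θ * j) * (({j} : Set ℕ).indicator 1 (M h ω) : ℝ)) P :=
    (hint _).add hintS
  refine ⟨∫ ω, Real.exp (-θ * M h ω) * (Set.Ioi k).indicator 1 (M h ω) ∂P,
    integral_nonneg hnn, ?_, ?_, ?_⟩
  · rw [← hval]
    exact integral_mono hintR (hint _) hle
  · rintro rfl
    simp [← hval]
  · simp_rw [← hval, ← integral_const_mul]
    rw [← integral_finsetSum _ fun j _ => (hint _).const_mul _, ← integral_add (hint _) hintS,
      ← integral_add hintS' hintR]
    exact integral_congr_ae (.of_forall fun ω => exp_neg_mul_nat_eq k θ (M h ω))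

lemma isLittleO_laplace (hM : IsGeneralizedCountingProcess k rate M P) {θ : ℝ} (hθ : 0 ≤ θ) :
    (fun h : ℝ≥0 => ∫ ω, Real.exp (-θ * M h ω) ∂P - 1 - h * laplaceExponent k rate θ)
      =o[𝓝[>] 0] (fun h : ℝ≥0 => (h : ℝ)) := by
  have hq0 := hM.isLittleO_stay
  have hqs := IsLittleO.sum fun j (hj : j ∈ Finset.Icc 1 k) => hM.isLittleO_jump hj
  have hqe := IsLittleO.sum fun j (hj : j ∈ Finset.Icc 1 k) =>
    (hM.isLittleO_jump hj).const_mul_left (Real.exp (-θ * j))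
  choose R hR0 hR1 _ hR2 using fun h : ℝ≥0 => hM.integral_exp_eq h hθ
  have htail : ∀ h : ℝ≥0, P.real (M h ⁻¹' Set.Ioi k) = 1 - P.real (M h ⁻¹' {0}) -
      ∑ j ∈ Finset.Icc 1 k, P.real (M h ⁻¹' {j}) := fun h => by
    obtain ⟨R', -, -, h1, h2⟩ := hM.integral_exp_eq h le_rfl
    simp only [neg_zero, zero_mul, Real.exp_zero, one_mul, integral_const, probReal_univ,
      one_smul] at h2
    linarith [h1 rfl]
  -- Individual estimates for `n > k` would not sum over infinitely many `n`. The tail is instead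
  -- one minus the probabilities of `0, …, k`, whose first-order terms cancel.
  have hR : R =o[𝓝[>] 0] (fun h : ℝ≥0 => (h : ℝ)) := by
    refine IsBigO.trans_isLittleO (IsBigO.of_bound 1 (.of_forall fun h => ?_))
      ((hq0.add hqs).neg_left)
    have := (hR1 h).trans_eq (htail h)
    rw [Real.norm_of_nonneg (hR0 h), one_mul]
    refine le_trans (this.trans_eq ?_) (le_abs_self _)
    rw [Finset.sum_apply, Finset.sum_sub_distrib, ← Finset.sum_mul]
    ring
  refine ((hq0.add hqe).add hR).congr_left fun h => ?_
  rw [hR2 h, laplaceExponent]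
  simp only [Finset.sum_apply, mul_sub, Finset.sum_sub_distrib, Finset.mul_sum, Finset.sum_mul,
    mul_one]
  have : ∀ j : ℕ, Real.exp (-θ * j) * (rate j * (h : ℝ)) = h * (rate j * Real.exp (-θ * j)) :=
    fun j => by ring
  simp_rw [this, mul_comm (rate _) (h : ℝ)]
  ring

theorem laplace (hM : IsGeneralizedCountingProcess k rate M P) (t : ℝ≥0) {θ : ℝ} (hθ : 0 ≤ θ) :
    ∫ ω, Real.exp (-θ * M t ω) ∂P = Real.exp (t * laplaceExponent k rate θ) := by
  rcases eq_or_ne t 0 with rfl | ht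
  · have := hM.levy.laplace_nsmul 0 0 θ
    simpa using this
  have htpos : 0 < t := pos_iff_ne_zero.2 ht
  have hlim : Tendsto (fun n : ℕ => t / n) atTop (𝓝[>] (0 : ℝ≥0)) := by
    refine tendsto_nhdsWithin_iff.2 ⟨tendsto_const_div_atTop_nhds_zero_nat t, ?_⟩
    filter_upwards [eventually_gt_atTop 0] with n hn
    exact div_pos htpos (by exact_mod_cast hn)
  have h1 := ((hM.isLittleO_laplace hθ).comp_tendsto hlim).tendsto_div_nhds_zero
  have h2 : Tendsto (fun n : ℕ => (n : ℝ) * (∫ ω, Real.exp (-θ * M (t / n) ω) ∂P - 1)) atTop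
      (𝓝 (t * laplaceExponent k rate θ)) := by
    have h3 := (h1.const_mul (t : ℝ)).add_const (t * laplaceExponent k rate θ)
    rw [mul_zero, zero_add] at h3
    refine h3.congr' ?_
    filter_upwards [eventually_gt_atTop 0] with n hn
    have hn' : (n : ℝ) ≠ 0 := by positivity
    have ht' : (t : ℝ) ≠ 0 := by exact_mod_cast ht
    simp only [Function.comp_apply, NNReal.coe_div, NNReal.coe_natCast]
    field_simp
    ring
  -- The transform at `t` is the `n`-th power of the transform at `t / n`, so the first-order
  -- expansion is exponentiated.
  have h3 := Real.tendsto_one_add_pow_exp_of_tendsto h2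
  refine tendsto_nhds_unique (tendsto_const_nhds.congr' ?_) h3
  filter_upwards [eventually_gt_atTop 0] with n hn
  rw [add_sub_cancel, ← hM.levy.laplace_nsmul, mul_div_cancel₀]
  exact_mod_cast hn.ne'

end IsGeneralizedCountingProcess

end CountingProcess

/-! ### Moments from the Laplace transform -/

section Moments

lemma tendsto_one_sub_exp_div (m : ℝ) :
    Tendsto (fun θ : ℝ => (1 - Real.exp (-θ * m)) / θ) (𝓝[>] 0) (𝓝 m) := by
  have h : HasDerivAt (fun θ : ℝ => -Real.exp (-θ * m)) m 0 := by
    have := (((hasDerivAt_id (0 : ℝ)).neg.mul_const m).exp).fun_neg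
    simpa using this
  have h2 := h.tendsto_slope_zero_right
  refine h2.congr' (.of_forall fun θ => ?_)
  simp
  ring

lemma one_sub_exp_div_bounds {m θ : ℝ} (hm : 0 ≤ m) (hθ : 0 < θ) :
    0 ≤ (1 - Real.exp (-θ * m)) / θ ∧ (1 - Real.exp (-θ * m)) / θ ≤ m := by
  constructor
  · refine div_nonneg (sub_nonneg.2 (Real.exp_le_one_iff.2 ?_)) hθ.le
    nlinarith
  · rw [div_le_iff₀ hθ]
    have := Real.add_one_le_exp (-θ * m)
    linarith

/-- The second difference quotient of a twice differentiable function. -/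
lemma tendsto_second_difference {g g' : ℝ → ℝ} {g2 : ℝ} (hg : ∀ θ, HasDerivAt g (g' θ) θ)
    (hg' : HasDerivAt g' g2 0) (h0 : g 0 = 1) :
    Tendsto (fun θ => (1 - 2 * g θ + g (2 * θ)) / θ ^ 2) (𝓝[>] 0) (𝓝 g2) := by
  have hcont : Continuous g := continuous_iff_continuousAt.2 fun θ => (hg θ).continuousAt
  refine HasDerivAt.lhopital_zero_nhdsGT (f' := fun θ => -(2 * g' θ) + g' (2 * θ) * 2)
    (g' := fun θ => 2 * θ) (.of_forall fun θ => ?_) (.of_forall fun θ => ?_) ?_ ?_ ?_ ?_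
  · have h1 : HasDerivAt (fun θ : ℝ => 2 * θ) 2 θ := by
      simpa using (hasDerivAt_id θ).const_mul (2 : ℝ)
    have h2 := (((hg θ).const_mul 2).const_sub 1).add ((hg (2 * θ)).comp θ h1)
    exact h2
  · simpa using hasDerivAt_pow 2 θ
  · filter_upwards [self_mem_nhdsWithin] with θ hθ
    exact mul_ne_zero two_ne_zero (ne_of_gt hθ)
  · have : Tendsto (fun θ => 1 - 2 * g θ + g (2 * θ)) (𝓝 0) (𝓝 (1 - 2 * g 0 + g (2 * 0))) :=
      Continuous.tendsto (by fun_prop) 0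
    rw [mul_zero, h0] at this
    norm_num at this
    exact this.mono_left nhdsWithin_le_nhds
  · have : Tendsto (fun θ : ℝ => θ ^ 2) (𝓝 0) (𝓝 (0 ^ 2)) := Continuous.tendsto (by fun_prop) 0
    rw [zero_pow two_ne_zero] at this
    exact this.mono_left nhdsWithin_le_nhds
  · have h1 : HasDerivAt (fun θ : ℝ => 2 * θ) 2 0 := by
      simpa using (hasDerivAt_id (0 : ℝ)).const_mul (2 : ℝ)
    have hg'' : HasDerivAt g' g2 (2 * 0) := by simpa using hg'
    have h2 : HasDerivAt (fun θ => -g' θ + g' (2 * θ)) (-g2 + g2 * 2) 0 :=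
      hg'.neg.add (hg''.comp (0 : ℝ) h1)
    have h3 := h2.tendsto_slope_zero_right
    rw [show -g2 + g2 * 2 = g2 by ring] at h3
    refine h3.congr' ?_
    filter_upwards [self_mem_nhdsWithin] with θ hθ
    have hθ' : θ ≠ 0 := ne_of_gt hθ
    simp only [zero_add, mul_zero, smul_eq_mul]
    field_simp
    ring

variable {Ω : Type*} [MeasurableSpace Ω] {P : Measure Ω} [IsProbabilityMeasure P]

/-- The first two moments of a non-negative random variable are determined by the first two
derivatives of its Laplace transform at `0`. -/
theorem moments_of_laplace {X : Ω → ℝ} (hX : Measurable X) (hX0 : ∀ ω, 0 ≤ X ω)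
    {g g' : ℝ → ℝ} {g2 : ℝ} (hL : ∀ θ, 0 ≤ θ → ∫ ω, Real.exp (-θ * X ω) ∂P = g θ)
    (hg : ∀ θ, HasDerivAt g (g' θ) θ) (hg' : HasDerivAt g' g2 0) :
    MemLp X 2 P ∧ ∫ ω, X ω ∂P = -g' 0 ∧ ∫ ω, X ω ^ 2 ∂P = g2 := by
  have h0 : g 0 = 1 := by simpa using (hL 0 le_rfl).symm
  have hexp : ∀ θ, 0 ≤ θ → Integrable (fun ω => Real.exp (-θ * X ω)) P := fun θ hθ =>
    Integrable.of_bound (Measurable.aestronglyMeasurable (by fun_prop)) 1 (.of_forall fun ω => by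
      rw [Real.norm_of_nonneg (Real.exp_pos _).le]
      exact Real.exp_le_one_iff.2 (by have := hX0 ω; nlinarith))
  have hsq : ∀ θ, 0 ≤ θ → Integrable (fun ω => ((1 - Real.exp (-θ * X ω)) / θ) ^ 2) P ∧
      ∫ ω, ((1 - Real.exp (-θ * X ω)) / θ) ^ 2 ∂P = (1 - 2 * g θ + g (2 * θ)) / θ ^ 2 := by
    intro θ hθ
    have e : ∀ ω, ((1 - Real.exp (-θ * X ω)) / θ) ^ 2 =
        (1 - 2 * Real.exp (-θ * X ω) + Real.exp (-(2 * θ) * X ω)) / θ ^ 2 := fun ω => by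
      rw [div_pow, show -(2 * θ) * X ω = -θ * X ω + -θ * X ω by ring, Real.exp_add]
      ring
    have i1 : Integrable (fun ω => 1 - 2 * Real.exp (-θ * X ω)) P :=
      (integrable_const _).sub ((hexp θ hθ).const_mul 2)
    have i2 := hexp (2 * θ) (by positivity)
    simp_rw [e]
    refine ⟨(i1.add i2).div_const _, ?_⟩
    rw [integral_div, integral_add i1 i2, integral_sub (integrable_const _)
      ((hexp θ hθ).const_mul 2), integral_const_mul, hL θ hθ, hL (2 * θ) (by positivity)]
    simp
  have hlim := tendsto_second_difference hg hg' h0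
  have hmem : MemLp X 2 P := by
    refine memLp_two_of_lintegral_sq_lt_top hX.aemeasurable ?_
    -- Fatou's lemma gives square integrability: `((1 - exp (-θ X)) / θ)^2` tends to `X^2`, and its
    -- expectation is the second difference quotient of `g`, which converges to `g2`. Once `X` is
    -- square integrable, it dominates the quotients and the limits of both moments are exact.
    have hF : ∀ ω, liminf (fun θ : ℝ => ENNReal.ofReal (((1 - Real.exp (-θ * X ω)) / θ) ^ 2))
        (𝓝[>] 0) = ENNReal.ofReal (X ω ^ 2) := fun ω =>
      ((ENNReal.continuous_ofReal.tendsto _).comp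
        ((tendsto_one_sub_exp_div (X ω)).pow 2)).liminf_eq
    have hG : liminf (fun θ : ℝ => ∫⁻ ω, ENNReal.ofReal (((1 - Real.exp (-θ * X ω)) / θ) ^ 2) ∂P)
        (𝓝[>] 0) = ENNReal.ofReal g2 := by
      refine Tendsto.liminf_eq (((ENNReal.continuous_ofReal.tendsto _).comp hlim).congr' ?_)
      filter_upwards [self_mem_nhdsWithin] with θ hθ
      rw [← ofReal_integral_eq_lintegral_ofReal (hsq θ (le_of_lt hθ)).1
        (.of_forall fun _ => sq_nonneg _), (hsq θ (le_of_lt hθ)).2]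
      rfl
    have := lintegral_liminf_le (μ := P) (u := 𝓝[>] (0 : ℝ))
      (f := fun (θ : ℝ) ω => ENNReal.ofReal (((1 - Real.exp (-θ * X ω)) / θ) ^ 2))
      (fun θ => by fun_prop)
    rw [hG] at this
    simp_rw [hF] at this
    exact lt_of_le_of_lt this ENNReal.ofReal_lt_top
  refine ⟨hmem, ?_, ?_⟩
  · have h1 : Tendsto (fun θ : ℝ => ∫ ω, (1 - Real.exp (-θ * X ω)) / θ ∂P) (𝓝[>] 0)
        (𝓝 (∫ ω, X ω ∂P)) := by
      refine tendsto_integral_filter_of_dominated_convergence X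
        (.of_forall fun θ => Measurable.aestronglyMeasurable (by fun_prop)) ?_
        (hmem.integrable one_le_two) (.of_forall fun ω => tendsto_one_sub_exp_div (X ω))
      filter_upwards [self_mem_nhdsWithin] with θ hθ
      refine .of_forall fun ω => ?_
      have := one_sub_exp_div_bounds (hX0 ω) hθ
      rw [Real.norm_of_nonneg this.1]
      exact this.2
    refine tendsto_nhds_unique h1 (((hg 0).neg.tendsto_slope_zero_right).congr' ?_)
    filter_upwards [self_mem_nhdsWithin] with θ hθ
    rw [integral_div, integral_sub (integrable_const _) (hexp θ (le_of_lt hθ)), hL θ (le_of_lt hθ)]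
    simp [h0]
    ring
  · have h1 : Tendsto (fun θ : ℝ => ∫ ω, ((1 - Real.exp (-θ * X ω)) / θ) ^ 2 ∂P) (𝓝[>] 0)
        (𝓝 (∫ ω, X ω ^ 2 ∂P)) := by
      refine tendsto_integral_filter_of_dominated_convergence (fun ω => X ω ^ 2)
        (.of_forall fun θ => Measurable.aestronglyMeasurable (by fun_prop)) ?_
        hmem.integrable_sq (.of_forall fun ω => (tendsto_one_sub_exp_div (X ω)).pow 2)
      filter_upwards [self_mem_nhdsWithin] with θ hθ
      refine .of_forall fun ω => ?_
      have := one_sub_exp_div_bounds (hX0 ω) hθ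
      rw [Real.norm_of_nonneg (sq_nonneg _)]
      exact pow_le_pow_left₀ this.1 this.2 2
    refine tendsto_nhds_unique h1 (hlim.congr' ?_)
    filter_upwards [self_mem_nhdsWithin] with θ hθ
    exact (hsq θ (le_of_lt hθ)).2.symm

end Moments

/-! ### Moments of the generalized counting process -/

section CountingProcess

variable {Ω : Type*} [MeasurableSpace Ω] {P : Measure Ω} [IsProbabilityMeasure P]
  {k : ℕ} {rate : ℕ → ℝ} {M : ℝ≥0 → Ω → ℕ}

lemma hasDerivAt_sum_mul_exp (k : ℕ) (a : ℕ → ℝ) (θ : ℝ) :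
    HasDerivAt (fun θ : ℝ => ∑ j ∈ Finset.Icc 1 k, a j * Real.exp (-θ * j))
      (∑ j ∈ Finset.Icc 1 k, (-(j * a j)) * Real.exp (-θ * j)) θ := by
  refine HasDerivAt.fun_sum fun j _ => ?_
  have := ((((hasDerivAt_id θ).neg.mul_const (j : ℝ))).exp).const_mul (a j)
  refine this.congr_deriv ?_
  simp
  ring

/-- The first two moments of the generalized counting process. -/
theorem IsGeneralizedCountingProcess.moments (hM : IsGeneralizedCountingProcess k rate M P)
    (t : ℝ≥0) :
    MemLp (fun ω => (M t ω : ℝ)) 2 P ∧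
    ∫ ω, (M t ω : ℝ) ∂P = (∑ j ∈ Finset.Icc 1 k, (j : ℝ) * rate j) * t ∧
    ∫ ω, (M t ω : ℝ) ^ 2 ∂P = (∑ j ∈ Finset.Icc 1 k, (j : ℝ) ^ 2 * rate j) * t +
      ((∑ j ∈ Finset.Icc 1 k, (j : ℝ) * rate j) * t) ^ 2 := by
  set ψ1 : ℝ → ℝ := fun θ => ∑ j ∈ Finset.Icc 1 k, (-(j * rate j)) * Real.exp (-θ * j) with hψ1
  set ψ2 : ℝ → ℝ := fun θ =>
    ∑ j ∈ Finset.Icc 1 k, (-(j * -(j * rate j))) * Real.exp (-θ * j) with hψ2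
  have d0 : ∀ θ, HasDerivAt (laplaceExponent k rate) (ψ1 θ) θ := fun θ => by
    have h := (hasDerivAt_sum_mul_exp k rate θ).sub_const (∑ j ∈ Finset.Icc 1 k, rate j)
    refine h.congr_of_eventuallyEq (.of_forall fun x => ?_)
    simp only [laplaceExponent, mul_sub, mul_one, Finset.sum_sub_distrib]
  have d1 : ∀ θ, HasDerivAt ψ1 (ψ2 θ) θ := fun θ =>
    hasDerivAt_sum_mul_exp k (fun j => -(j * rate j)) θ
  have e1 : ψ1 0 = -∑ j ∈ Finset.Icc 1 k, (j : ℝ) * rate j := by simp [hψ1]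
  have e2 : ψ2 0 = ∑ j ∈ Finset.Icc 1 k, (j : ℝ) ^ 2 * rate j := by
    simp only [hψ2, neg_zero, zero_mul, Real.exp_zero, mul_one]
    exact Finset.sum_congr rfl fun j _ => by ring
  have e0 : laplaceExponent k rate 0 = 0 := by simp [laplaceExponent]
  have D0 : ∀ θ, HasDerivAt (fun θ => Real.exp (t * laplaceExponent k rate θ))
      (Real.exp (t * laplaceExponent k rate θ) * (t * ψ1 θ)) θ := fun θ =>
    ((d0 θ).const_mul (t : ℝ)).exp
  have D1 := (D0 0).mul ((d1 0).const_mul (t : ℝ))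
  obtain ⟨h1, h2, h3⟩ := moments_of_laplace (hM.levy.measurable t) (fun ω => Nat.cast_nonneg _)
    (fun θ hθ => hM.laplace t hθ) D0 D1
  refine ⟨h1, h2.trans ?_, h3.trans ?_⟩
  · rw [e0, e1]
    simp
    ring
  · rw [e0, e1, e2]
    simp
    ring

lemma IsGeneralizedCountingProcess.integral_mul (hM : IsGeneralizedCountingProcess k rate M P)
    {s t : ℝ≥0} (hst : s ≤ t) :
    ∫ ω, (M s ω : ℝ) * M t ω ∂P = (∑ j ∈ Finset.Icc 1 k, (j : ℝ) ^ 2 * rate j) * s +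
      (∑ j ∈ Finset.Icc 1 k, (j : ℝ) * rate j) ^ 2 * s * t := by
  obtain ⟨hs, es, es2⟩ := hM.moments s
  obtain ⟨ht, et, -⟩ := hM.moments t
  have hd : MemLp (fun ω => (M t ω : ℝ) - M s ω) 2 P := ht.sub hs
  have h1 : ∫ ω, (M s ω : ℝ) * (M t ω - M s ω) ∂P =
      (∫ ω, (M s ω : ℝ) ∂P) * ∫ ω, ((M t ω : ℝ) - M s ω) ∂P :=
    (hM.levy.indepFun_increment hst).integral_mul_eq_mul_integral hs.1 hd.1
  have h3 : ∀ ω, (M s ω : ℝ) * M t ω = (M s ω : ℝ) ^ 2 + M s ω * (M t ω - M s ω) := fun ω => by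
    ring
  have hi : Integrable (fun ω => (M s ω : ℝ) * (M t ω - M s ω)) P := hs.integrable_mul hd
  simp_rw [h3]
  rw [integral_add hs.integrable_sq hi, es2, h1,
    integral_sub (ht.integrable one_le_two) (hs.integrable one_le_two), es, et]
  ring

end CountingProcess

/-! ### Moments under an independent time change -/

section TimeChange

variable {Ω : Type*} [MeasurableSpace Ω] {P : Measure Ω} [IsProbabilityMeasure P]
  {X : ℝ≥0 → Ω → ℝ} {τ τ' : Ω → ℝ≥0}

lemma memLp_comp_random_time (hX : ∀ t, MemLp (X t) 2 P)
    (hrc : ∀ᵐ ω ∂P, ∀ t, ContinuousWithinAt (fun u => X u ω) (Set.Ici t) t)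
    (hτ : AEMeasurable τ P) (hind : IndepFun (fun ω t => X t ω) (fun ω => (τ ω, τ ω)) P)
    (hint : Integrable (fun ω' => ∫ ω, X (τ ω') ω ^ 2 ∂P) P) :
    MemLp (fun ω => X (τ ω) ω) 2 P := by
  refine memLp_two_of_lintegral_sq_lt_top
    (aemeasurable_comp_random_time (fun t => (hX t).1.aemeasurable) hrc hτ) ?_
  have h := lintegral_comp_random_times (fun t => (hX t).1.aemeasurable) hrc (hτ.prodMk hτ) hind
    (φ := fun z => ENNReal.ofReal (z.1 ^ 2)) (by fun_prop)
  simp only at h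
  rw [h]
  refine lt_of_eq_of_lt (lintegral_congr fun ω' => ?_) hint.lintegral_lt_top
  rw [ofReal_integral_eq_lintegral_ofReal (hX _).integrable_sq (.of_forall fun _ => sq_nonneg _)]

lemma integral_comp_random_time (hX : ∀ t, MemLp (X t) 2 P)
    (hrc : ∀ᵐ ω ∂P, ∀ t, ContinuousWithinAt (fun u => X u ω) (Set.Ici t) t)
    (hτ : AEMeasurable τ P) (hind : IndepFun (fun ω t => X t ω) (fun ω => (τ ω, τ ω)) P)
    (hint : MemLp (fun ω => X (τ ω) ω) 2 P) :
    ∫ ω, X (τ ω) ω ∂P = ∫ ω', ∫ ω, X (τ ω') ω ∂P ∂P :=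
  (integrable_comp_random_times (fun t => (hX t).1.aemeasurable) hrc (hτ.prodMk hτ) hind
    (φ := fun z => z.1) (by fun_prop) (hint.integrable one_le_two)).2

lemma integral_mul_comp_random_times (hX : ∀ t, MemLp (X t) 2 P)
    (hrc : ∀ᵐ ω ∂P, ∀ t, ContinuousWithinAt (fun u => X u ω) (Set.Ici t) t)
    (hτ : AEMeasurable τ P) (hτ' : AEMeasurable τ' P)
    (hind : IndepFun (fun ω t => X t ω) (fun ω => (τ ω, τ' ω)) P)
    (h₁ : MemLp (fun ω => X (τ ω) ω) 2 P) (h₂ : MemLp (fun ω => X (τ' ω) ω) 2 P) :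
    Integrable (fun ω' => ∫ ω, X (τ ω') ω * X (τ' ω') ω ∂P) P ∧
    ∫ ω, X (τ ω) ω * X (τ' ω) ω ∂P = ∫ ω', ∫ ω, X (τ ω') ω * X (τ' ω') ω ∂P ∂P :=
  integrable_comp_random_times (fun t => (hX t).1.aemeasurable) hrc (hτ.prodMk hτ') hind
    (φ := fun z => z.1 * z.2) (by fun_prop) (h₁.integrable_mul h₂)

end TimeChange

/-! ### Moments of the Skellam process and its fractional version -/

section SkellamProcess

variable {Ω : Type*} [MeasurableSpace Ω] {P : Measure Ω} [IsProbabilityMeasure P]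
  {k : ℕ} {lam mu : ℕ → ℝ} {M₁ M₂ : ℝ≥0 → Ω → ℕ}

/-- The mean of the generalized Skellam process at time `1`. -/
noncomputable def gspMean (k : ℕ) (lam mu : ℕ → ℝ) : ℝ :=
  ∑ j ∈ Finset.Icc 1 k, (j : ℝ) * (lam j - mu j)

/-- The variance of the generalized Skellam process at time `1`. -/
noncomputable def gspVar (k : ℕ) (lam mu : ℕ → ℝ) : ℝ :=
  ∑ j ∈ Finset.Icc 1 k, (j : ℝ) ^ 2 * (lam j + mu j)

lemma gspVar_pos (hk : 1 ≤ k) (hlam : ∀ j ∈ Finset.Icc 1 k, 0 < lam j)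
    (hmu : ∀ j ∈ Finset.Icc 1 k, 0 < mu j) : 0 < gspVar k lam mu :=
  Finset.sum_pos (fun j hj => by
    have h1 := hlam j hj
    have h2 := hmu j hj
    have h3 : 1 ≤ j := (Finset.mem_Icc.1 hj).1
    positivity) ⟨1, by simp [hk]⟩

omit [MeasurableSpace Ω] in
lemma gsp_coe (M₁ M₂ : ℝ≥0 → Ω → ℕ) (t : ℝ≥0) :
    (fun ω => (gsp M₁ M₂ t ω : ℝ)) = fun ω => (M₁ t ω : ℝ) - M₂ t ω := by
  ext ω
  simp [gsp]

omit [IsProbabilityMeasure P] in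
lemma gsp_rightContinuous (hM₁ : IsGeneralizedCountingProcess k lam M₁ P)
    (hM₂ : IsGeneralizedCountingProcess k mu M₂ P) :
    ∀ᵐ ω ∂P, ∀ t, ContinuousWithinAt (fun u => (gsp M₁ M₂ u ω : ℝ)) (Set.Ici t) t := by
  filter_upwards [hM₁.levy.cadlag, hM₂.levy.cadlag] with ω h1 h2 t
  refine ((h1 t).1.sub (h2 t).1).congr (fun u _ => ?_) ?_ <;> simp [gsp]

lemma gsp_memLp (hM₁ : IsGeneralizedCountingProcess k lam M₁ P)
    (hM₂ : IsGeneralizedCountingProcess k mu M₂ P) (t : ℝ≥0) :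
    MemLp (fun ω => (gsp M₁ M₂ t ω : ℝ)) 2 P := by
  rw [gsp_coe]
  exact (hM₁.moments t).1.sub (hM₂.moments t).1

lemma gsp_integral (hM₁ : IsGeneralizedCountingProcess k lam M₁ P)
    (hM₂ : IsGeneralizedCountingProcess k mu M₂ P) (t : ℝ≥0) :
    ∫ ω, (gsp M₁ M₂ t ω : ℝ) ∂P = gspMean k lam mu * t := by
  obtain ⟨h1, e1, -⟩ := hM₁.moments t
  obtain ⟨h2, e2, -⟩ := hM₂.moments t
  rw [gsp_coe, integral_sub (h1.integrable one_le_two) (h2.integrable one_le_two), e1, e2, gspMean,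
    ← sub_mul, ← Finset.sum_sub_distrib]
  simp_rw [mul_sub]

omit [IsProbabilityMeasure P] in
lemma IndepProcesses.integral_mul (hM : IndepProcesses M₁ M₂ P)
    (hM₁ : IsGeneralizedCountingProcess k lam M₁ P)
    (hM₂ : IsGeneralizedCountingProcess k mu M₂ P) (s t : ℝ≥0) :
    ∫ ω, (M₁ s ω : ℝ) * M₂ t ω ∂P = (∫ ω, (M₁ s ω : ℝ) ∂P) * ∫ ω, (M₂ t ω : ℝ) ∂P := by
  have hcast : Measurable (fun n : ℕ => (n : ℝ)) := measurable_from_nat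
  have h : IndepFun (fun ω => (M₁ s ω : ℝ)) (fun ω => (M₂ t ω : ℝ)) P :=
    IndepFun.comp (φ := fun p : ℝ≥0 → ℕ => (p s : ℝ)) (ψ := fun p : ℝ≥0 → ℕ => (p t : ℝ)) hM
      (hcast.comp (measurable_pi_apply s)) (hcast.comp (measurable_pi_apply t))
  exact h.integral_fun_mul_eq_mul_integral (hM₁.levy.measurable s).aestronglyMeasurable
    (hM₂.levy.measurable t).aestronglyMeasurable

lemma gsp_integral_mul (hM₁ : IsGeneralizedCountingProcess k lam M₁ P)
    (hM₂ : IsGeneralizedCountingProcess k mu M₂ P) (hM : IndepProcesses M₁ M₂ P) {s t : ℝ≥0}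
    (hst : s ≤ t) :
    ∫ ω, (gsp M₁ M₂ s ω : ℝ) * gsp M₁ M₂ t ω ∂P =
      gspVar k lam mu * s + gspMean k lam mu ^ 2 * (s * t) := by
  obtain ⟨h1, e1, -⟩ := hM₁.moments s
  obtain ⟨h2, e2, -⟩ := hM₂.moments s
  obtain ⟨h1', e1', -⟩ := hM₁.moments t
  obtain ⟨h2', e2', -⟩ := hM₂.moments t
  have c12 := hM.integral_mul hM₁ hM₂ s t
  have c21 := hM.integral_mul hM₁ hM₂ t s
  have c11 := hM₁.integral_mul hst
  have c22 := hM₂.integral_mul hst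
  have i11 : Integrable (fun ω => (M₁ s ω : ℝ) * M₁ t ω) P := h1.integrable_mul h1'
  have i22 : Integrable (fun ω => (M₂ s ω : ℝ) * M₂ t ω) P := h2.integrable_mul h2'
  have i12 : Integrable (fun ω => (M₁ s ω : ℝ) * M₂ t ω) P := h1.integrable_mul h2'
  have i21 : Integrable (fun ω => (M₁ t ω : ℝ) * M₂ s ω) P := h1'.integrable_mul h2
  have e : ∀ ω, (gsp M₁ M₂ s ω : ℝ) * gsp M₁ M₂ t ω =
      (M₁ s ω : ℝ) * M₁ t ω + M₂ s ω * M₂ t ω - (M₁ s ω * M₂ t ω + M₁ t ω * M₂ s ω) := fun ω => by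
    simp only [gsp]
    push_cast
    ring
  have hm : gspMean k lam mu = ∑ j ∈ Finset.Icc 1 k, (j : ℝ) * lam j -
      ∑ j ∈ Finset.Icc 1 k, (j : ℝ) * mu j := by
    simp only [gspMean, mul_sub, Finset.sum_sub_distrib]
  have hv : gspVar k lam mu = ∑ j ∈ Finset.Icc 1 k, (j : ℝ) ^ 2 * lam j +
      ∑ j ∈ Finset.Icc 1 k, (j : ℝ) ^ 2 * mu j := by
    simp only [gspVar, mul_add, Finset.sum_add_distrib]
  have iA : Integrable (fun ω => (M₁ s ω : ℝ) * M₁ t ω + M₂ s ω * M₂ t ω) P := i11.add i22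
  have iB : Integrable (fun ω => (M₁ s ω : ℝ) * M₂ t ω + M₁ t ω * M₂ s ω) P := i12.add i21
  simp_rw [e]
  rw [integral_sub iA iB, integral_add i11 i22, integral_add i12 i21, c11, c22, c12, c21, e1, e2,
    e1', e2', hm, hv]
  ring

variable {α : ℝ} {L : ℝ≥0 → Ω → ℝ≥0}

omit [MeasurableSpace Ω] in
lemma gfsp_of_lt_one (hα₁ : α < 1) (S : ℝ≥0 → Ω → ℤ) (Y : ℝ≥0 → Ω → ℝ≥0) :
    gfsp α S Y = fun t ω => S (Y t ω) ω := by
  ext t ω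
  simp [gfsp, hα₁]

omit [IsProbabilityMeasure P] in
lemma IndepProcesses.indepFun_pair {S : ℝ≥0 → Ω → ℤ} {Y : ℝ≥0 → Ω → ℝ≥0}
    (h : IndepProcesses S Y P) (s t : ℝ≥0) :
    IndepFun (fun ω u => (S u ω : ℝ)) (fun ω => (Y s ω, Y t ω)) P := by
  have hcast : Measurable (fun n : ℤ => (n : ℝ)) := .of_discrete
  exact IndepFun.comp (φ := fun (p : ℝ≥0 → ℤ) u => (p u : ℝ)) (ψ := fun p : ℝ≥0 → ℝ≥0 => (p s, p t))
    h (measurable_pi_lambda _ fun u => hcast.comp (measurable_pi_apply u))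
    ((measurable_pi_apply s).prodMk (measurable_pi_apply t))

/-- Regularity and first two moments of the generalized fractional Skellam process. -/
theorem gfsp_moments (hα₀ : 0 < α) (hα₁ : α < 1)
    (hM₁ : IsGeneralizedCountingProcess k lam M₁ P)
    (hM₂ : IsGeneralizedCountingProcess k mu M₂ P) (hM : IndepProcesses M₁ M₂ P)
    (hL : IsStableSubordinator α L P) (hSY : IndepProcesses (gsp M₁ M₂) (firstPassage L) P) :
    (∀ᵐ ω ∂P, ∀ t, ContinuousWithinAt
      (fun u => (gfsp α (gsp M₁ M₂) (firstPassage L) u ω : ℝ)) (Set.Ici t) t) ∧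
    (∀ t, MemLp (fun ω => (gfsp α (gsp M₁ M₂) (firstPassage L) t ω : ℝ)) 2 P) ∧
    (∀ t, ∫ ω, (gfsp α (gsp M₁ M₂) (firstPassage L) t ω : ℝ) ∂P =
      gspMean k lam mu * (∫ ω, (firstPassage L 1 ω : ℝ) ∂P) * (t : ℝ) ^ α) ∧
    ∀ s t, s ≤ t → ∫ ω, (gfsp α (gsp M₁ M₂) (firstPassage L) s ω : ℝ) *
        gfsp α (gsp M₁ M₂) (firstPassage L) t ω ∂P =
      gspVar k lam mu * (∫ ω, (firstPassage L 1 ω : ℝ) ∂P) * (s : ℝ) ^ α +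
        gspMean k lam mu ^ 2 * ∫ ω, (firstPassage L s ω : ℝ) * firstPassage L t ω ∂P := by
  rw [gfsp_of_lt_one hα₁]
  have hrc := gsp_rightContinuous hM₁ hM₂
  have hS := gsp_memLp hM₁ hM₂
  have hY := hL.aemeasurable_firstPassage
  have hind := fun s t => hSY.indepFun_pair s t
  have hmem : ∀ t, MemLp (fun ω => (gsp M₁ M₂ (firstPassage L t ω) ω : ℝ)) 2 P := fun t => by
    refine memLp_comp_random_time (X := fun t ω => (gsp M₁ M₂ t ω : ℝ)) hS hrc (hY t)
      (hind t t) ?_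
    have e : ∀ a, ∫ ω, (gsp M₁ M₂ a ω : ℝ) ^ 2 ∂P =
        gspVar k lam mu * a + gspMean k lam mu ^ 2 * (a * a) := fun a => by
      simp_rw [sq, ← sq (gspMean k lam mu)]
      exact gsp_integral_mul hM₁ hM₂ hM le_rfl
    simp_rw [e]
    exact ((hL.integrable_firstPassage t).const_mul _).add
      ((hL.integrable_firstPassage_mul t t).const_mul _)
  refine ⟨?_, hmem, fun t => ?_, fun s t hst => ?_⟩
  · filter_upwards [hrc, hL.tendsto_atTop] with ω h1 h2 t
    exact continuousWithinAt_comp_firstPassage h2 h1 t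
  · have h := integral_comp_random_time (X := fun t ω => (gsp M₁ M₂ t ω : ℝ)) hS hrc (hY t)
      (hind t t) (hmem t)
    rw [h]
    simp_rw [gsp_integral hM₁ hM₂]
    rw [integral_const_mul, hL.integral_firstPassage hα₀]
    ring
  · have h := (integral_mul_comp_random_times (X := fun t ω => (gsp M₁ M₂ t ω : ℝ)) hS hrc (hY s)
      (hY t) (hind s t) (hmem s) (hmem t)).2
    rw [h]
    -- With the times frozen, monotonicity of `Y` preserves their order, as the covariance formula
    -- for the Skellam process requires.
    have e : ∀ᵐ ω' ∂P, ∫ ω, (gsp M₁ M₂ (firstPassage L s ω') ω : ℝ) *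
        gsp M₁ M₂ (firstPassage L t ω') ω ∂P = gspVar k lam mu * (firstPassage L s ω' : ℝ) +
        gspMean k lam mu ^ 2 * ((firstPassage L s ω' : ℝ) * firstPassage L t ω') := by
      filter_upwards [hL.ae_firstPassage_mono] with ω' h1
      exact gsp_integral_mul hM₁ hM₂ hM (h1 hst)
    rw [integral_congr_ae e, integral_add ((hL.integrable_firstPassage s).const_mul _)
      ((hL.integrable_firstPassage_mul s t).const_mul _), integral_const_mul, integral_const_mul,
      hL.integral_firstPassage hα₀]
    ring

end SkellamProcess

/-! ### Increments of a concave power -/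

section Rpow

lemma add_rpow_sub_rpow_le {α a x : ℝ} (hα₀ : 0 ≤ α) (hα₁ : α ≤ 1) (ha : 0 ≤ a) (hx : 0 < x) :
    (x + a) ^ α - x ^ α ≤ α * a * x ^ (-(1 - α)) := by
  have h1 : x + a = x * (1 + a / x) := by field_simp
  have h2 := rpow_one_add_le_one_add_mul_self (s := a / x) (p := α)
    (by have : 0 ≤ a / x := by positivity
        linarith) hα₀ hα₁
  rw [h1, Real.mul_rpow hx.le (by positivity)]
  have h3 : x ^ (-(1 - α)) = x ^ α / x := by
    rw [neg_sub, Real.rpow_sub_one hx.ne']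
  rw [h3]
  calc x ^ α * (1 + a / x) ^ α - x ^ α ≤ x ^ α * (1 + α * (a / x)) - x ^ α := by gcongr
    _ = α * a * (x ^ α / x) := by ring

/-- The increments of `y ↦ y ^ α` over intervals of fixed length vanish at infinity if `α < 1`. -/
lemma tendsto_rpow_sub_rpow {α : ℝ} (hα₀ : 0 ≤ α) (hα₁ : α < 1) {a : ℝ} (ha : 0 ≤ a) :
    Tendsto (fun y : ℝ => y ^ α - (y - a) ^ α) atTop (𝓝 0) := by
  have h1 : Tendsto (fun y : ℝ => α * a * (y - a) ^ (-(1 - α))) atTop (𝓝 0) := by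
    have := (tendsto_rpow_neg_atTop (sub_pos.2 hα₁)).comp (tendsto_atTop_add_const_right _ (-a)
      tendsto_id)
    simpa [sub_eq_add_neg] using this.const_mul (α * a)
  refine tendsto_of_tendsto_of_tendsto_of_le_of_le' tendsto_const_nhds h1 ?_ ?_
  · filter_upwards [eventually_ge_atTop a] with y hy
    exact sub_nonneg.2 (Real.rpow_le_rpow (sub_nonneg.2 hy) (by linarith) hα₀)
  · filter_upwards [eventually_gt_atTop a] with y hy
    simpa using add_rpow_sub_rpow_le hα₀ hα₁.le ha (sub_pos.2 hy)

end Rpow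

/-! ### Fractional moments of the outer subordinator -/

section Subordinator

variable {Ω : Type*} [MeasurableSpace Ω] {P : Measure Ω} [IsProbabilityMeasure P]
  {D : ℝ≥0 → Ω → ℝ≥0} {α : ℝ}

namespace IsSubordinator

omit [IsProbabilityMeasure P] in
lemma ae_eq_zero_nsmul (hD : IsSubordinator D P) {s : ℝ≥0} (h : ∀ᵐ ω ∂P, D s ω = 0) (n : ℕ) :
    ∀ᵐ ω ∂P, D (n * s) ω = 0 := by
  induction n with
  | zero =>
    filter_upwards [hD.levy.zero] with ω hω
    simpa using hω
  | succ n ih =>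
    have h1 := (hD.levy.stationary (n * s) s).symm.ae_snd (p := fun z : ℝ => z = 0)
      (measurableSet_singleton 0) (by
        filter_upwards [h] with ω hω
        simpa using hω)
    filter_upwards [h1, ih] with ω h2 h3
    rw [Nat.cast_succ, add_mul, one_mul]
    simpa [h3] using h2

omit [IsProbabilityMeasure P] in
-- Vanishing at one positive time would spread to all its multiples by stationarity, while the
-- `α`-moments diverge.
lemma not_ae_eq_zero (hα₀ : 0 < α) (hD : IsSubordinator D P)
    (htop : Tendsto (fun t : ℝ≥0 => ∫ ω, (D t ω : ℝ) ^ α ∂P) atTop atTop) {s : ℝ≥0} (hs : 0 < s) :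
    ¬ ∀ᵐ ω ∂P, D s ω = 0 := fun h => by
  have h1 : Tendsto (fun n : ℕ => (n : ℝ≥0) * s) atTop atTop :=
    tendsto_natCast_atTop_atTop.atTop_mul_const hs
  obtain ⟨n, hn⟩ := ((htop.comp h1).eventually_gt_atTop 0).exists
  have h2 : ∫ ω, (D (n * s) ω : ℝ) ^ α ∂P = 0 := by
    refine integral_eq_zero_of_ae ?_
    filter_upwards [hD.ae_eq_zero_nsmul h n] with ω hω
    simp [hω, Real.zero_rpow hα₀.ne']
  exact hn.ne' h2

omit [IsProbabilityMeasure P] in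
lemma integral_rpow_pos (hα₀ : 0 < α) (hD : IsSubordinator D P)
    (hint : ∀ t, Integrable (fun ω => (D t ω : ℝ) ^ α) P)
    (htop : Tendsto (fun t : ℝ≥0 => ∫ ω, (D t ω : ℝ) ^ α ∂P) atTop atTop) {s : ℝ≥0} (hs : 0 < s) :
    0 < ∫ ω, (D s ω : ℝ) ^ α ∂P := by
  refine lt_of_le_of_ne (integral_nonneg fun ω => by positivity) fun h => ?_
  refine hD.not_ae_eq_zero hα₀ htop hs ?_
  filter_upwards [(integral_eq_zero_iff_of_nonneg (fun ω => by positivity) (hint s)).1 h.symm]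
    with ω hω
  simpa [Real.rpow_eq_zero_iff_of_nonneg, hα₀.ne'] using hω

lemma tendsto_atTop_of_moment (hα₀ : 0 < α) (hD : IsSubordinator D P)
    (htop : Tendsto (fun t : ℝ≥0 => ∫ ω, (D t ω : ℝ) ^ α ∂P) atTop atTop) :
    ∀ᵐ ω ∂P, Tendsto (fun t => D t ω) atTop atTop := by
  refine hD.tendsto_atTop ?_
  have h1 : ∀ n : ℕ, ∫ ω, Real.exp (-(D n ω : ℝ)) ∂P =
      (∫ ω, Real.exp (-(D 1 ω : ℝ)) ∂P) ^ n := fun n => by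
    simpa using hD.levy.laplace_nsmul n 1 1
  have hint : Integrable (fun ω => Real.exp (-(D 1 ω : ℝ))) P :=
    Integrable.of_bound ((hD.levy.measurable 1).neg.exp).aestronglyMeasurable 1
      (.of_forall fun ω => by simp)
  simp_rw [h1]
  -- Since `D 1` is not almost surely zero, `E exp (-D 1) < 1`, and its powers are the transforms at
  -- integer times.
  refine tendsto_pow_atTop_nhds_zero_of_lt_one (integral_nonneg fun ω => (Real.exp_pos _).le) ?_
  have h2 : 0 ≤ fun ω => 1 - Real.exp (-(D 1 ω : ℝ)) := fun ω => by simp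
  have h3 : ∫ ω, (1 - Real.exp (-(D 1 ω : ℝ))) ∂P = 1 - ∫ ω, Real.exp (-(D 1 ω : ℝ)) ∂P := by
    rw [integral_sub (integrable_const _) hint]
    simp
  refine lt_of_le_of_ne ?_ fun h => ?_
  · have := integral_nonneg (μ := P) h2
    linarith
  · rw [h, sub_self] at h3
    refine hD.not_ae_eq_zero hα₀ htop one_pos ?_
    filter_upwards [(integral_eq_zero_iff_of_nonneg h2 ((integrable_const _).sub hint)).1 h3]
      with ω hω
    have h4 : Real.exp (-(D 1 ω : ℝ)) = 1 := by
      simp only [Pi.zero_apply] at hω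
      linarith
    simpa using h4

omit [IsProbabilityMeasure P] in
lemma ae_le (hD : IsSubordinator D P) {s t : ℝ≥0} (hst : s ≤ t) :
    ∀ᵐ ω ∂P, (D s ω : ℝ) ≤ D t ω :=
  hD.monotone.mono fun _ h => by exact_mod_cast h hst

omit [IsProbabilityMeasure P] in
lemma memLp_rpow (hD : IsSubordinator D P)
    (hint2 : ∀ t, Integrable (fun ω => (D t ω : ℝ) ^ (2 * α)) P) (t : ℝ≥0) :
    MemLp (fun ω => (D t ω : ℝ) ^ α) 2 P := by
  have hm := hD.levy.measurable t
  rw [memLp_two_iff_integrable_sq (Measurable.aestronglyMeasurable (by fun_prop))]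
  refine (hint2 t).congr (.of_forall fun ω => ?_)
  simp only
  rw [mul_comm, Real.rpow_mul (by simp)]
  norm_num

omit [IsProbabilityMeasure P] in
lemma memLp_increment_rpow (hα₀ : 0 < α) (hD : IsSubordinator D P)
    (hint2 : ∀ t, Integrable (fun ω => (D t ω : ℝ) ^ (2 * α)) P) {s t : ℝ≥0} (hst : s ≤ t) :
    MemLp (fun ω => ((D t ω : ℝ) - D s ω) ^ α) 2 P := by
  have hs := hD.levy.measurable s
  have ht := hD.levy.measurable t
  refine (hD.memLp_rpow hint2 t).mono (Measurable.aestronglyMeasurable (by fun_prop)) ?_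
  filter_upwards [hD.ae_le hst] with ω hω
  have h0 := sub_nonneg.2 hω
  have h1 := (D s ω).coe_nonneg
  rw [Real.norm_of_nonneg (by positivity), Real.norm_of_nonneg (by positivity)]
  exact Real.rpow_le_rpow h0 (by linarith) hα₀.le

omit [IsProbabilityMeasure P] in
lemma integral_increment_rpow (hD : IsSubordinator D P) (s h : ℝ≥0) :
    ∫ ω, ((D (s + h) ω : ℝ) - D s ω) ^ α ∂P = ∫ ω, (D h ω : ℝ) ^ α ∂P :=
  ((hD.levy.stationary s h).comp (u := fun x : ℝ => x ^ α) (by fun_prop)).integral_eq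

omit [IsProbabilityMeasure P] in
lemma integral_mul_increment_rpow (hD : IsSubordinator D P) (s h : ℝ≥0) :
    ∫ ω, (D s ω : ℝ) ^ α * ((D (s + h) ω : ℝ) - D s ω) ^ α ∂P =
      (∫ ω, (D s ω : ℝ) ^ α ∂P) * ∫ ω, (D h ω : ℝ) ^ α ∂P := by
  have hm : Measurable (fun x : ℝ => x ^ α) := by fun_prop
  have hs := hD.levy.measurable s
  have ht := hD.levy.measurable (s + h)
  have h1 := (hD.levy.indepFun_increment (s := s) (t := s + h)
    (le_add_of_nonneg_right zero_le)).comp hm hm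
  rw [← hD.integral_increment_rpow s h]
  exact h1.integral_mul_eq_mul_integral (hm.comp hs).aestronglyMeasurable
    (hm.comp (ht.sub hs)).aestronglyMeasurable

lemma rpow_sub_rpow_bounds {a y : ℝ} (hα₀ : 0 ≤ α) (hα₁ : α ≤ 1) (ha : 0 ≤ a) (hy : a ≤ y) :
    0 ≤ y ^ α - (y - a) ^ α ∧ y ^ α - (y - a) ^ α ≤ a ^ α := by
  have h0 := sub_nonneg.2 hy
  refine ⟨sub_nonneg.2 (Real.rpow_le_rpow h0 (by linarith) hα₀), ?_⟩
  have := Real.rpow_add_le_add_rpow h0 ha hα₀ hα₁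
  rw [sub_add_cancel] at this
  linarith

/-- Asymptotic decorrelation of the moments of a subordinator at a fixed and at a late time. -/
theorem tendsto_moment_differences (hα₀ : 0 < α) (hα₁ : α < 1) (hD : IsSubordinator D P)
    (hint2 : ∀ t, Integrable (fun ω => (D t ω : ℝ) ^ (2 * α)) P)
    (htop : Tendsto (fun t : ℝ≥0 => ∫ ω, (D t ω : ℝ) ^ α ∂P) atTop atTop) (s : ℝ≥0) :
    Tendsto (fun h : ℝ≥0 => ∫ ω, (D (s + h) ω : ℝ) ^ α ∂P - ∫ ω, (D h ω : ℝ) ^ α ∂P) atTop (𝓝 0) ∧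
    Tendsto (fun h : ℝ≥0 => ∫ ω, (D s ω : ℝ) ^ α * (D (s + h) ω : ℝ) ^ α ∂P -
      (∫ ω, (D s ω : ℝ) ^ α ∂P) * ∫ ω, (D (s + h) ω : ℝ) ^ α ∂P) atTop (𝓝 0) := by
  have hst : ∀ h : ℝ≥0, s ≤ s + h := fun h => le_add_of_nonneg_right zero_le
  have hL2 := fun t => hD.memLp_rpow hint2 t
  have hL2' := fun h => hD.memLp_increment_rpow hα₀ hint2 (hst h)
  have hm := hD.levy.measurable
  -- Replacing `D(s+h)^α` by the `α`-power of the increment costs at most `D(s)^α`, uniformly in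
  -- `h`. This is the dominating function for both limits; after the replacement, stationarity and
  -- independence evaluate the integrals.
  have hbound : ∀ h : ℝ≥0, ∀ᵐ ω ∂P,
      0 ≤ (D (s + h) ω : ℝ) ^ α - ((D (s + h) ω : ℝ) - D s ω) ^ α ∧
      (D (s + h) ω : ℝ) ^ α - ((D (s + h) ω : ℝ) - D s ω) ^ α ≤ (D s ω : ℝ) ^ α := fun h => by
    filter_upwards [hD.ae_le (hst h)] with ω hω
    exact rpow_sub_rpow_bounds hα₀.le hα₁.le (by simp) hω
  have hlim : ∀ᵐ ω ∂P, Tendsto (fun h : ℝ≥0 =>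
      (D (s + h) ω : ℝ) ^ α - ((D (s + h) ω : ℝ) - D s ω) ^ α) atTop (𝓝 0) := by
    filter_upwards [hD.tendsto_atTop_of_moment hα₀ htop] with ω hω
    have h1 : Tendsto (fun h : ℝ≥0 => (D (s + h) ω : ℝ)) atTop atTop :=
      NNReal.tendsto_coe_atTop.2 (hω.comp
        (tendsto_atTop_mono (fun h => le_add_of_nonneg_left zero_le) tendsto_id))
    exact (tendsto_rpow_sub_rpow hα₀.le hα₁ (D s ω).coe_nonneg).comp h1
  have t1 : Tendsto (fun h : ℝ≥0 => ∫ ω, ((D (s + h) ω : ℝ) ^ α -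
      ((D (s + h) ω : ℝ) - D s ω) ^ α) ∂P) atTop (𝓝 0) := by
    have := tendsto_integral_filter_of_dominated_convergence (μ := P) (l := atTop)
      (F := fun (h : ℝ≥0) ω => (D (s + h) ω : ℝ) ^ α - ((D (s + h) ω : ℝ) - D s ω) ^ α)
      (f := fun _ => 0) (fun ω => (D s ω : ℝ) ^ α)
      (.of_forall fun h => Measurable.aestronglyMeasurable
        (by have h1 := hm s
            have h2 := hm (s + h)
            fun_prop))
      (.of_forall fun h => by
        filter_upwards [hbound h] with ω hω
        rw [Real.norm_of_nonneg hω.1]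
        exact hω.2)
      ((hL2 s).integrable one_le_two) hlim
    simpa using this
  have t2 : Tendsto (fun h : ℝ≥0 => ∫ ω, (D s ω : ℝ) ^ α * ((D (s + h) ω : ℝ) ^ α -
      ((D (s + h) ω : ℝ) - D s ω) ^ α) ∂P) atTop (𝓝 0) := by
    have := tendsto_integral_filter_of_dominated_convergence (μ := P) (l := atTop)
      (F := fun (h : ℝ≥0) ω => (D s ω : ℝ) ^ α *
        ((D (s + h) ω : ℝ) ^ α - ((D (s + h) ω : ℝ) - D s ω) ^ α))
      (f := fun _ => 0) (fun ω => (D s ω : ℝ) ^ α * (D s ω : ℝ) ^ α)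
      (.of_forall fun h => Measurable.aestronglyMeasurable
        (by have h1 := hm s
            have h2 := hm (s + h)
            fun_prop))
      (.of_forall fun h => by
        filter_upwards [hbound h] with ω hω
        rw [Real.norm_of_nonneg (mul_nonneg (by positivity) hω.1)]
        exact mul_le_mul_of_nonneg_left hω.2 (by positivity))
      ((hL2 s).integrable_mul (hL2 s)) (by
        filter_upwards [hlim] with ω hω
        simpa using hω.const_mul ((D s ω : ℝ) ^ α))
    simpa using this
  have e1 : ∀ h : ℝ≥0, ∫ ω, ((D (s + h) ω : ℝ) ^ α - ((D (s + h) ω : ℝ) - D s ω) ^ α) ∂P =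
      ∫ ω, (D (s + h) ω : ℝ) ^ α ∂P - ∫ ω, (D h ω : ℝ) ^ α ∂P := fun h => by
    rw [integral_sub ((hL2 _).integrable one_le_two) ((hL2' h).integrable one_le_two),
      hD.integral_increment_rpow]
  have e2 : ∀ h : ℝ≥0, ∫ ω, (D s ω : ℝ) ^ α * ((D (s + h) ω : ℝ) ^ α -
      ((D (s + h) ω : ℝ) - D s ω) ^ α) ∂P = ∫ ω, (D s ω : ℝ) ^ α * (D (s + h) ω : ℝ) ^ α ∂P -
        (∫ ω, (D s ω : ℝ) ^ α ∂P) * ∫ ω, (D h ω : ℝ) ^ α ∂P := fun h => by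
    have i1 : Integrable (fun ω => (D s ω : ℝ) ^ α * (D (s + h) ω : ℝ) ^ α) P :=
      (hL2 s).integrable_mul (hL2 (s + h))
    have i2 : Integrable (fun ω => (D s ω : ℝ) ^ α * ((D (s + h) ω : ℝ) - D s ω) ^ α) P :=
      (hL2 s).integrable_mul (hL2' h)
    simp_rw [mul_sub]
    rw [integral_sub i1 i2, hD.integral_mul_increment_rpow]
  simp_rw [e1] at t1
  simp_rw [e2] at t2
  refine ⟨t1, ?_⟩
  -- The limit `t2` has `E D(h)^α` in place of `E D(s+h)^α`; subtracting `E D(s)^α` times `t1`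
  -- exchanges them.
  have t3 := t2.sub (t1.const_mul (∫ ω, (D s ω : ℝ) ^ α ∂P))
  rw [mul_zero, sub_zero] at t3
  exact t3.congr fun h => by ring

end IsSubordinator

end Subordinator

/-! ### Moments of the time-changed process -/

section TCGFSP

variable {Ω : Type*} [MeasurableSpace Ω] {P : Measure Ω} [IsProbabilityMeasure P]
  {k : ℕ} {lam mu : ℕ → ℝ} {M₁ M₂ : ℝ≥0 → Ω → ℕ} {α : ℝ} {L D : ℝ≥0 → Ω → ℝ≥0}

/-- Moments of the time-changed generalized fractional Skellam process: mean, second moment and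
two-sided bounds for the mixed second moments. -/
theorem tcgfspI_moments (hα₀ : 0 < α) (hα₁ : α < 1)
    (hM₁ : IsGeneralizedCountingProcess k lam M₁ P)
    (hM₂ : IsGeneralizedCountingProcess k mu M₂ P) (hM : IndepProcesses M₁ M₂ P)
    (hL : IsStableSubordinator α L P) (hSY : IndepProcesses (gsp M₁ M₂) (firstPassage L) P)
    (hD : IsSubordinator D P) (hint : ∀ t, Integrable (fun ω => (D t ω : ℝ) ^ α) P)
    (hint2 : ∀ t, Integrable (fun ω => (D t ω : ℝ) ^ (2 * α)) P)
    (hSD : IndepProcesses (gfsp α (gsp M₁ M₂) (firstPassage L)) D P) :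
    (∀ t, MemLp (fun ω => (tcgfspI α M₁ M₂ L D t ω : ℝ)) 2 P) ∧
    (∀ t, ∫ ω, (tcgfspI α M₁ M₂ L D t ω : ℝ) ∂P =
      gspMean k lam mu * (∫ ω, (firstPassage L 1 ω : ℝ) ∂P) * ∫ ω, (D t ω : ℝ) ^ α ∂P) ∧
    (∀ t, ∫ ω, (tcgfspI α M₁ M₂ L D t ω : ℝ) ^ 2 ∂P =
      gspVar k lam mu * (∫ ω, (firstPassage L 1 ω : ℝ) ∂P) * ∫ ω, (D t ω : ℝ) ^ α ∂P +
        gspMean k lam mu ^ 2 * ((∫ ω, (firstPassage L 1 ω : ℝ) ^ 2 ∂P) *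
          ∫ ω, (D t ω : ℝ) ^ (2 * α) ∂P)) ∧
    ∀ s h,
      gspVar k lam mu * (∫ ω, (firstPassage L 1 ω : ℝ) ∂P) * ∫ ω, (D s ω : ℝ) ^ α ∂P +
        gspMean k lam mu ^ 2 * ((∫ ω, (firstPassage L 1 ω : ℝ) ^ 2 ∂P) / 2 *
          ∫ ω, (D s ω : ℝ) ^ (2 * α) ∂P + (∫ ω, (firstPassage L 1 ω : ℝ) ∂P) ^ 2 *
            ((∫ ω, (D s ω : ℝ) ^ α ∂P) * ∫ ω, (D h ω : ℝ) ^ α ∂P)) ≤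
        ∫ ω, (tcgfspI α M₁ M₂ L D s ω : ℝ) * tcgfspI α M₁ M₂ L D (s + h) ω ∂P ∧
      ∫ ω, (tcgfspI α M₁ M₂ L D s ω : ℝ) * tcgfspI α M₁ M₂ L D (s + h) ω ∂P ≤
        gspVar k lam mu * (∫ ω, (firstPassage L 1 ω : ℝ) ∂P) * ∫ ω, (D s ω : ℝ) ^ α ∂P +
        gspMean k lam mu ^ 2 * ((∫ ω, (firstPassage L 1 ω : ℝ) ^ 2 ∂P) / 2 *
          ∫ ω, (D s ω : ℝ) ^ (2 * α) ∂P + (∫ ω, (firstPassage L 1 ω : ℝ) ∂P) ^ 2 *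
            ∫ ω, (D s ω : ℝ) ^ α * (D (s + h) ω : ℝ) ^ α ∂P) := by
  obtain ⟨hrc, hX, hmean, hmul⟩ := gfsp_moments hα₀ hα₁ hM₁ hM₂ hM hL hSY
  have hbounds := hL.integral_firstPassage_mul_bounds hα₀
  have hsq1 := hL.integral_sq_firstPassage hα₀
  generalize hG : gfsp α (gsp M₁ M₂) (firstPassage L) = G at hSD hrc hX hmean hmul
  have hZ : ∀ t ω, tcgfspI α M₁ M₂ L D t ω = G (D t ω) ω := fun t ω => by
    rw [← hG]
    rfl
  generalize gspMean k lam mu = m at *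
  generalize gspVar k lam mu = v at *
  generalize ∫ ω, (firstPassage L 1 ω : ℝ) ∂P = c at *
  generalize ∫ ω, (firstPassage L 1 ω : ℝ) ^ 2 ∂P = b at *
  have hDm : ∀ t, AEMeasurable (D t) P := fun t => (hD.measurable t).aemeasurable
  have hind := fun s t => hSD.indepFun_pair s t
  have hsq : ∀ a, ∫ ω, (G a ω : ℝ) ^ 2 ∂P = v * c * (a : ℝ) ^ α + m ^ 2 * (b * (a : ℝ) ^ (2 * α)) :=
    fun a => by
      have := hmul a a le_rfl
      simp_rw [← sq] at this
      rw [this, hsq1, mul_comm b]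
  have hmem : ∀ t, MemLp (fun ω => (G (D t ω) ω : ℝ)) 2 P := fun t => by
    refine memLp_comp_random_time (X := fun t ω => (G t ω : ℝ)) hX hrc (hDm t) (hind t t) ?_
    simp_rw [hsq]
    exact ((hint t).const_mul _).add (((hint2 t).const_mul _).const_mul _)
  simp_rw [hZ]
  refine ⟨hmem, fun t => ?_, fun t => ?_, fun s h => ?_⟩
  · rw [integral_comp_random_time (X := fun t ω => (G t ω : ℝ)) hX hrc (hDm t) (hind t t) (hmem t)]
    simp_rw [hmean]
    rw [integral_const_mul]
  · have e := (integral_mul_comp_random_times (X := fun t ω => (G t ω : ℝ)) hX hrc (hDm t) (hDm t)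
      (hind t t) (hmem t) (hmem t)).2
    simp_rw [← sq, hsq] at e
    rw [e, integral_add ((hint t).const_mul _) (((hint2 t).const_mul _).const_mul _),
      integral_const_mul, integral_const_mul, integral_const_mul]
  · have hst : s ≤ s + h := le_add_of_nonneg_right zero_le
    obtain ⟨hi, e⟩ := integral_mul_comp_random_times (X := fun t ω => (G t ω : ℝ)) hX hrc (hDm s)
      (hDm (s + h)) (hind s (s + h)) (hmem s) (hmem (s + h))
    have hL2 := fun t => hD.memLp_rpow hint2 t
    have i1 : Integrable (fun ω => (D s ω : ℝ) ^ α * (D (s + h) ω : ℝ) ^ α) P :=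
      (hL2 s).integrable_mul (hL2 (s + h))
    have i2 : Integrable (fun ω => (D s ω : ℝ) ^ α * ((D (s + h) ω : ℝ) - D s ω) ^ α) P :=
      (hL2 s).integrable_mul (hD.memLp_increment_rpow hα₀ hint2 hst)
    have hval : ∀ {f : Ω → ℝ}, Integrable f P →
        Integrable (fun ω => v * c * (D s ω : ℝ) ^ α +
          m ^ 2 * (b / 2 * (D s ω : ℝ) ^ (2 * α) + c ^ 2 * f ω)) P ∧
        ∫ ω, (v * c * (D s ω : ℝ) ^ α +
          m ^ 2 * (b / 2 * (D s ω : ℝ) ^ (2 * α) + c ^ 2 * f ω)) ∂P =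
        v * c * ∫ ω, (D s ω : ℝ) ^ α ∂P +
          m ^ 2 * (b / 2 * ∫ ω, (D s ω : ℝ) ^ (2 * α) ∂P + c ^ 2 * ∫ ω, f ω ∂P) := fun {f} hf => by
      have j1 := (hint s).const_mul (v * c)
      have j2 := (hint2 s).const_mul (b / 2)
      have j3 := hf.const_mul (c ^ 2)
      have j4 : Integrable (fun ω => b / 2 * (D s ω : ℝ) ^ (2 * α) + c ^ 2 * f ω) P := j2.add j3
      refine ⟨j1.add (j4.const_mul _), ?_⟩
      rw [integral_add j1 (j4.const_mul _), integral_const_mul, integral_const_mul,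
        integral_add j2 j3, integral_const_mul, integral_const_mul]
    rw [e]
    have hH : ∀ᵐ ω' ∂P, ∃ d : ℝ≥0, D (s + h) ω' = D s ω' + d ∧
        ((D (s + h) ω' : ℝ) - D s ω' = d) ∧ ∫ ω, (G (D s ω') ω : ℝ) * G (D (s + h) ω') ω ∂P =
        v * c * (D s ω' : ℝ) ^ α +
          m ^ 2 * ∫ ω, (firstPassage L (D s ω') ω : ℝ) * firstPassage L (D s ω' + d) ω ∂P := by
      filter_upwards [hD.monotone] with ω' hω'
      have h1 := hω' hst
      have h2 := (add_tsub_cancel_of_le h1).symm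
      refine ⟨D (s + h) ω' - D s ω', h2, (NNReal.coe_sub h1).symm, ?_⟩
      rw [← h2]
      exact hmul _ _ h1
    constructor
    -- The lower bound involves the increment `d` itself, so independence factors its expectation.
    -- The upper bound below involves `D(s+h)`, so its mixed moment stays unfactored.
    · rw [← hD.integral_mul_increment_rpow, ← (hval i2).2]
      refine integral_mono_ae (hval i2).1 hi ?_
      filter_upwards [hH] with ω' ⟨d, h1, h2, h3⟩
      rw [h3, h2]
      gcongr
      exact (hbounds _ _).1
    · rw [← (hval i1).2]
      refine integral_mono_ae hi (hval i1).1 ?_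
      filter_upwards [hH] with ω' ⟨d, h1, h2, h3⟩
      rw [h3, h1]
      gcongr
      exact (hbounds _ _).2

end TCGFSP

/-! ### From variance growth to correlation decay -/

section Decay

variable {Ω : Type*} [MeasurableSpace Ω] {P : Measure Ω}

lemma tendsto_nnreal_rpow_neg {ρ : ℝ} (hρ : 0 < ρ) :
    Tendsto (fun t : ℝ≥0 => (t : ℝ) ^ (-ρ)) atTop (𝓝 0) :=
  (tendsto_rpow_neg_atTop hρ).comp (NNReal.tendsto_coe_atTop.2 tendsto_id)

/-- With the covariance tending to `J` and the standard deviation of `X t` asymptotic to `√K t^γ`,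
the constant is `c(s) = J / √(Var X(s) · K)`. -/
lemma corrDecay_of_tendsto {X : ℝ≥0 → Ω → ℝ} {γ K : ℝ} (hK : 0 < K)
    (hvar : Tendsto (fun t : ℝ≥0 => Var[X t; P] / (t : ℝ) ^ (2 * γ)) atTop (𝓝 K))
    (hpos : ∀ s : ℝ≥0, 0 < s → 0 < Var[X s; P])
    (hcov : ∀ s : ℝ≥0, 0 < s → ∃ J : ℝ, 0 < J ∧
      Tendsto (fun t : ℝ≥0 => cov[X s, X t; P]) atTop (𝓝 J)) :
    CorrDecay X γ P := by
  intro s hs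
  obtain ⟨J, hJ, hlim⟩ := hcov s hs
  have hV := hpos s hs
  have hc : 0 < J / Real.sqrt (Var[X s; P] * K) := by positivity
  refine ⟨_, hc, ?_⟩
  refine isEquivalent_of_tendsto_one ?_
  have h1 : Tendsto (fun t : ℝ≥0 => cov[X s, X t; P] /
      Real.sqrt (Var[X s; P] * (Var[X t; P] / (t : ℝ) ^ (2 * γ))) /
      (J / Real.sqrt (Var[X s; P] * K))) atTop (𝓝 1) := by
    have h2 := (hlim.div (hvar.const_mul Var[X s; P]).sqrt (by positivity)).div_const
      (J / Real.sqrt (Var[X s; P] * K))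
    rwa [div_self hc.ne'] at h2
  refine h1.congr' ?_
  filter_upwards [eventually_gt_atTop 0] with t ht
  have ht' : (0 : ℝ) < t := ht
  have e : (t : ℝ) ^ (2 * γ) = ((t : ℝ) ^ γ) ^ 2 := by
    rw [mul_comm, Real.rpow_mul ht'.le]
    norm_num
  have hp : 0 < (t : ℝ) ^ γ := by positivity
  simp only [Pi.div_apply, corr]
  rw [e, Real.rpow_neg ht'.le, ← mul_div_assoc, Real.sqrt_div (by have := hpos t ht; positivity),
    Real.sqrt_sq hp.le]
  field_simp

lemma not_isWeaklyStationary_of_tendsto [IsProbabilityMeasure P] {X : ℝ≥0 → Ω → ℝ}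
    (hX : ∀ t, MemLp (X t) 2 P)
    {γ K : ℝ} (hγ : 0 < γ) (hK : 0 < K)
    (hvar : Tendsto (fun t : ℝ≥0 => Var[X t; P] / (t : ℝ) ^ (2 * γ)) atTop (𝓝 K)) :
    ¬ IsWeaklyStationary X P := by
  -- Shift invariance on the diagonal makes the variance constant, so its quotient by `t^(2γ)` would
  -- tend to `0` instead of `K`.
  rintro ⟨-, h⟩
  have h1 : ∀ t, Var[X t; P] = Var[X 0; P] := fun t => by
    have := h 0 0 t
    rwa [zero_add, covariance_self (hX t).1.aemeasurable,
      covariance_self (hX 0).1.aemeasurable] at this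
  simp_rw [h1] at hvar
  have h2 := (tendsto_nnreal_rpow_neg (ρ := 2 * γ) (by positivity)).const_mul Var[X 0; P]
  rw [mul_zero] at h2
  refine hK.ne (tendsto_nhds_unique h2 (hvar.congr fun t => ?_))
  rw [Real.rpow_neg t.coe_nonneg, div_eq_mul_inv]

end Decay

/-! ### Growth of moments; linearity of the mean -/

section Subordinator

variable {Ω : Type*} [MeasurableSpace Ω] {P : Measure Ω} [IsProbabilityMeasure P]
  {D : ℝ≥0 → Ω → ℝ≥0}

lemma tendsto_div_rpow_of_isEquivalent {A : ℝ≥0 → ℝ} {κ ρ : ℝ} (hκ : κ ≠ 0)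
    (h : A ~[atTop] fun t : ℝ≥0 => κ * (t : ℝ) ^ ρ) :
    Tendsto (fun t : ℝ≥0 => A t / (t : ℝ) ^ ρ) atTop (𝓝 κ) := by
  have hne : ∀ᶠ t : ℝ≥0 in atTop, κ * (t : ℝ) ^ ρ ≠ 0 := by
    filter_upwards [eventually_gt_atTop 0] with t ht
    have : (0 : ℝ) < t := ht
    positivity
  have h1 := ((isEquivalent_iff_tendsto_one hne).1 h).const_mul κ
  rw [mul_one] at h1
  refine h1.congr' ?_
  filter_upwards [hne] with t ht
  have := right_ne_zero_of_mul ht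
  simp only [Pi.div_apply]
  field_simp

lemma tendsto_atTop_of_isEquivalent {A : ℝ≥0 → ℝ} {κ ρ : ℝ} (hκ : 0 < κ) (hρ : 0 < ρ)
    (h : A ~[atTop] fun t : ℝ≥0 => κ * (t : ℝ) ^ ρ) : Tendsto A atTop atTop :=
  h.symm.tendsto_atTop (((tendsto_rpow_atTop hρ).comp
    (NNReal.tendsto_coe_atTop.2 tendsto_id)).const_mul_atTop hκ)

omit [IsProbabilityMeasure P] in
lemma IsSubordinator.integral_natCast (hD : IsSubordinator D P)
    (hint : ∀ t, Integrable (fun ω => (D t ω : ℝ)) P) (n : ℕ) :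
    ∫ ω, (D n ω : ℝ) ∂P = n * ∫ ω, (D 1 ω : ℝ) ∂P := by
  induction n with
  | zero =>
    rw [Nat.cast_zero, Nat.cast_zero, zero_mul]
    exact integral_eq_zero_of_ae hD.levy.zero
  | succ n ih =>
    have h := (hD.levy.stationary n 1).integral_eq
    rw [integral_sub (hint _) (hint _), ih] at h
    push_cast
    linarith

omit [IsProbabilityMeasure P] in
/-- The mean of an integrable subordinator grows linearly. -/
lemma IsSubordinator.not_isEquivalent_sublinear (hD : IsSubordinator D P)
    (hint : ∀ t, Integrable (fun ω => (D t ω : ℝ)) P) {κ ρ : ℝ} (hκ : 0 < κ) (hρ₀ : 0 < ρ)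
    (hρ₁ : ρ < 1)
    (h : (fun t : ℝ≥0 => ∫ ω, (D t ω : ℝ) ∂P) ~[atTop] fun t : ℝ≥0 => κ * (t : ℝ) ^ ρ) :
    False := by
  have hN : Tendsto (fun n : ℕ => (n : ℝ≥0)) atTop atTop := tendsto_natCast_atTop_atTop
  have h1 := ((tendsto_div_rpow_of_isEquivalent hκ.ne' h).mul
    (tendsto_nnreal_rpow_neg (sub_pos.2 hρ₁))).comp hN
  rw [mul_zero] at h1
  have h2 : ∫ ω, (D 1 ω : ℝ) ∂P = 0 := by
    refine tendsto_nhds_unique (tendsto_const_nhds.congr' ?_) h1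
    filter_upwards [eventually_gt_atTop 0] with n hn
    have hn' : (0 : ℝ) < n := by exact_mod_cast hn
    have e : (n : ℝ) ^ (-(1 - ρ)) = (n : ℝ) ^ ρ / n := by
      rw [neg_sub, Real.rpow_sub_one hn'.ne']
    have hp : 0 < (n : ℝ) ^ ρ := by positivity
    simp only [Function.comp_apply, NNReal.coe_natCast]
    rw [hD.integral_natCast hint, e]
    field_simp
  obtain ⟨n, hn⟩ :=
    (((tendsto_atTop_of_isEquivalent hκ hρ₀ h).comp hN).eventually_gt_atTop 0).exists
  simp only [Function.comp_apply] at hn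
  rw [hD.integral_natCast hint, h2, mul_zero] at hn
  exact lt_irrefl _ hn

end Subordinator

/-! ### Variance and limiting covariance -/

section LongRangeDependence

variable {Ω : Type*} [MeasurableSpace Ω] {P : Measure Ω} [IsProbabilityMeasure P]
  {k : ℕ} {lam mu : ℕ → ℝ} {M₁ M₂ : ℝ≥0 → Ω → ℕ} {α : ℝ} {L D : ℝ≥0 → Ω → ℝ≥0}

lemma sq_integral_rpow_le (hD : IsSubordinator D P)
    (hint2 : ∀ t, Integrable (fun ω => (D t ω : ℝ) ^ (2 * α)) P) (t : ℝ≥0) :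
    (∫ ω, (D t ω : ℝ) ^ α ∂P) ^ 2 ≤ ∫ ω, (D t ω : ℝ) ^ (2 * α) ∂P := by
  have h1 := variance_eq_sub (hD.memLp_rpow hint2 t)
  have h2 := variance_nonneg (fun ω => (D t ω : ℝ) ^ α) P
  have e : ∫ ω, ((D t ω : ℝ) ^ α) ^ 2 ∂P = ∫ ω, (D t ω : ℝ) ^ (2 * α) ∂P := by
    refine integral_congr_ae (.of_forall fun ω => ?_)
    simp only
    rw [mul_comm, Real.rpow_mul (by simp)]
    norm_num
  simp only [Pi.pow_apply, e] at h1
  linarith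

lemma tcgfspI_variance_covariance (hk : 1 ≤ k) (hlam : ∀ j ∈ Finset.Icc 1 k, 0 < lam j)
    (hmu : ∀ j ∈ Finset.Icc 1 k, 0 < mu j) (hα₀ : 0 < α) (hα₁ : α < 1)
    (hM₁ : IsGeneralizedCountingProcess k lam M₁ P)
    (hM₂ : IsGeneralizedCountingProcess k mu M₂ P) (hM : IndepProcesses M₁ M₂ P)
    (hL : IsStableSubordinator α L P) (hSY : IndepProcesses (gsp M₁ M₂) (firstPassage L) P)
    (hD : IsSubordinator D P) (hint : ∀ t, Integrable (fun ω => (D t ω : ℝ) ^ α) P)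
    (hint2 : ∀ t, Integrable (fun ω => (D t ω : ℝ) ^ (2 * α)) P)
    (hSD : IndepProcesses (gfsp α (gsp M₁ M₂) (firstPassage L)) D P)
    (htop : Tendsto (fun t : ℝ≥0 => ∫ ω, (D t ω : ℝ) ^ α ∂P) atTop atTop) :
    (∀ t, Var[fun ω => (tcgfspI α M₁ M₂ L D t ω : ℝ); P] =
      gspVar k lam mu * (∫ ω, (firstPassage L 1 ω : ℝ) ∂P) * ∫ ω, (D t ω : ℝ) ^ α ∂P +
        gspMean k lam mu ^ 2 * ((∫ ω, (firstPassage L 1 ω : ℝ) ^ 2 ∂P) *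
          ∫ ω, (D t ω : ℝ) ^ (2 * α) ∂P -
            (∫ ω, (firstPassage L 1 ω : ℝ) ∂P) ^ 2 * (∫ ω, (D t ω : ℝ) ^ α ∂P) ^ 2)) ∧
    (∀ s : ℝ≥0, 0 < s → 0 < Var[fun ω => (tcgfspI α M₁ M₂ L D s ω : ℝ); P]) ∧
    ∀ s : ℝ≥0, 0 < s → ∃ J : ℝ, 0 < J ∧ Tendsto (fun t : ℝ≥0 =>
      cov[fun ω => (tcgfspI α M₁ M₂ L D s ω : ℝ), fun ω => (tcgfspI α M₁ M₂ L D t ω : ℝ); P])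
      atTop (𝓝 J) := by
  obtain ⟨hmem, hmean, hsq, hmul⟩ :=
    tcgfspI_moments hα₀ hα₁ hM₁ hM₂ hM hL hSY hD hint hint2 hSD
  have hv : 0 < gspVar k lam mu := gspVar_pos hk hlam hmu
  have hc := hL.integral_firstPassage_one_pos
  have hb := hL.sq_integral_firstPassage_one_lt hα₁
  have hvar : ∀ t, Var[fun ω => (tcgfspI α M₁ M₂ L D t ω : ℝ); P] =
      gspVar k lam mu * (∫ ω, (firstPassage L 1 ω : ℝ) ∂P) * ∫ ω, (D t ω : ℝ) ^ α ∂P +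
        gspMean k lam mu ^ 2 * ((∫ ω, (firstPassage L 1 ω : ℝ) ^ 2 ∂P) *
          ∫ ω, (D t ω : ℝ) ^ (2 * α) ∂P -
            (∫ ω, (firstPassage L 1 ω : ℝ) ∂P) ^ 2 * (∫ ω, (D t ω : ℝ) ^ α ∂P) ^ 2) := fun t => by
    rw [variance_eq_sub (hmem t)]
    simp only [Pi.pow_apply]
    rw [hsq, hmean]
    ring
  have hpos := fun s (hs : 0 < s) => hD.integral_rpow_pos hα₀ hint htop (s := s) hs
  have hjensen := fun s => sq_integral_rpow_le hD hint2 s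
  refine ⟨hvar, fun s hs => ?_, fun s hs => ?_⟩
  · rw [hvar]
    have h1 := hpos s hs
    -- The `v`-term is already positive. The other is nonnegative because `b ≥ c^2` and, by
    -- nonnegativity of the variance of `D(s)^α`, `E D(s)^(2α) ≥ (E D(s)^α)^2`.
    refine add_pos_of_pos_of_nonneg (by positivity) (mul_nonneg (sq_nonneg _) (sub_nonneg.2 ?_))
    exact mul_le_mul hb.le (hjensen s) (sq_nonneg _) ((sq_nonneg _).trans hb.le)
  · have h1 := hpos s hs
    have hB : 0 ≤ ∫ ω, (D s ω : ℝ) ^ (2 * α) ∂P := integral_nonneg fun ω => by positivity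
    have hb0 : 0 < ∫ ω, (firstPassage L 1 ω : ℝ) ^ 2 ∂P := lt_of_le_of_lt (sq_nonneg _) hb
    obtain ⟨t1, t2⟩ := hD.tendsto_moment_differences hα₀ hα₁ hint2 htop s
    have hcov : ∀ t, cov[fun ω => (tcgfspI α M₁ M₂ L D s ω : ℝ),
        fun ω => (tcgfspI α M₁ M₂ L D t ω : ℝ); P] =
        ∫ ω, (tcgfspI α M₁ M₂ L D s ω : ℝ) * tcgfspI α M₁ M₂ L D t ω ∂P -
          gspMean k lam mu ^ 2 * (∫ ω, (firstPassage L 1 ω : ℝ) ∂P) ^ 2 *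
            ((∫ ω, (D s ω : ℝ) ^ α ∂P) * ∫ ω, (D t ω : ℝ) ^ α ∂P) := fun t => by
      rw [covariance_eq_sub (hmem s) (hmem t), hmean, hmean]
      simp only [Pi.mul_apply]
      ring
    generalize gspMean k lam mu = m at *
    generalize gspVar k lam mu = v at *
    generalize ∫ ω, (firstPassage L 1 ω : ℝ) ∂P = c at *
    generalize ∫ ω, (firstPassage L 1 ω : ℝ) ^ 2 ∂P = b at *
    set A := ∫ ω, (D s ω : ℝ) ^ α ∂P
    set B := ∫ ω, (D s ω : ℝ) ^ (2 * α) ∂P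
    refine ⟨v * c * A + m ^ 2 * (b / 2 * B), by positivity, ?_⟩
    have key : Tendsto (fun h : ℝ≥0 => cov[fun ω => (tcgfspI α M₁ M₂ L D s ω : ℝ),
        fun ω => (tcgfspI α M₁ M₂ L D (s + h) ω : ℝ); P]) atTop
        (𝓝 (v * c * A + m ^ 2 * (b / 2 * B))) := by
      -- After subtracting the product of the means, the lower bound falls short of the limit by
      -- `m^2 c^2 A (E D(s+h)^α - E D(h)^α)`, and the upper bound exceeds it by `m^2 c^2` times the
      -- covariance of `D(s)^α` and `D(s+h)^α`. Both errors vanish.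
      have l1 := (t1.const_mul (m ^ 2 * c ^ 2 * A)).const_sub (v * c * A + m ^ 2 * (b / 2 * B))
      have l2 := (t2.const_mul (m ^ 2 * c ^ 2)).const_add (v * c * A + m ^ 2 * (b / 2 * B))
      rw [mul_zero, sub_zero] at l1
      rw [mul_zero, add_zero] at l2
      refine tendsto_of_tendsto_of_tendsto_of_le_of_le l1 l2 (fun h => ?_) (fun h => ?_)
      · simp only
        rw [hcov]
        linarith [(hmul s h).1]
      · simp only
        rw [hcov]
        linarith [(hmul s h).2]
    have hsub : Tendsto (fun t : ℝ≥0 => t - s) atTop atTop := by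
      refine tendsto_atTop.2 fun a => ?_
      filter_upwards [eventually_ge_atTop (a + s)] with t ht
      exact le_tsub_of_add_le_right ht
    refine (key.comp hsub).congr' ?_
    filter_upwards [eventually_ge_atTop s] with t ht
    simp only [Function.comp_apply, add_tsub_cancel_of_le ht]

end LongRangeDependence

end Skellam

/-! ### The long-range dependence theorem -/

theorem mainTheorem2 {Ω : Type*} [MeasurableSpace Ω] (P : Measure Ω) [IsProbabilityMeasure P]
    (k : ℕ) (hk : 1 ≤ k) (lam mu : ℕ → ℝ)
    (hlam : ∀ j ∈ Finset.Icc 1 k, 0 < lam j) (hmu : ∀ j ∈ Finset.Icc 1 k, 0 < mu j)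
    (α : ℝ) (hα₀ : 0 < α) (hα₁ : α ≤ 1)
    -- the two independent generalized counting processes
    (M₁ M₂ : ℝ≥0 → Ω → ℕ)
    (hM₁ : Skellam.IsGeneralizedCountingProcess k lam M₁ P)
    (hM₂ : Skellam.IsGeneralizedCountingProcess k mu M₂ P)
    (hM : Skellam.IndepProcesses M₁ M₂ P)
    -- the stable subordinator, whose inverse is independent of the generalized Skellam process
    (L : ℝ≥0 → Ω → ℝ≥0) (hL : Skellam.IsStableSubordinator α L P)
    (hSY : Skellam.IndepProcesses (Skellam.gsp M₁ M₂) (Skellam.firstPassage L) P)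
    -- the subordinator with finite moments, independent of the fractional Skellam process
    (D : ℝ≥0 → Ω → ℝ≥0) (hD : Skellam.IsSubordinator D P)
    (hDmom : ∀ (r : ℝ), 0 < r → ∀ t, Integrable (fun ω => (D t ω : ℝ) ^ r) P)
    (hSD : Skellam.IndepProcesses
      (Skellam.gfsp α (Skellam.gsp M₁ M₂) (Skellam.firstPassage L)) D P)
    -- the asymptotic behaviour of the moments of order `α` and `2α`
    (ρ k₁ k₂ : ℝ) (hρ₀ : 0 < ρ) (hρ₁ : ρ < 1) (hk₁ : 0 < k₁) (hk₂ : k₁ ^ 2 ≤ k₂)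
    (hD₁ : (fun t : ℝ≥0 => ∫ ω, (D t ω : ℝ) ^ α ∂P) ~[atTop]
      (fun t : ℝ≥0 => k₁ * (t : ℝ) ^ ρ))
    (hD₂ : (fun t : ℝ≥0 => ∫ ω, (D t ω : ℝ) ^ (2 * α) ∂P) ~[atTop]
      (fun t : ℝ≥0 => k₂ * (t : ℝ) ^ (2 * ρ))) :
    -- long-range dependence of the time-changed generalized fractional Skellam process-I
    Skellam.HasLRD (fun t ω => (Skellam.tcgfspI α M₁ M₂ L D t ω : ℝ)) P ∧
      (∑ j ∈ Finset.Icc 1 k, (j : ℝ) * (lam j - mu j) ≠ 0 →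
        Skellam.CorrDecay (fun t ω => (Skellam.tcgfspI α M₁ M₂ L D t ω : ℝ)) ρ P) := by
  rcases hα₁.lt_or_eq with hα₁ | rfl
  swap
  -- For `α = 1` the first asymptotic relation asserts sublinear growth of a linear mean, so the
  -- case is vacuous.
  · simp only [Real.rpow_one] at hD₁
    have hint : ∀ t, Integrable (fun ω => (D t ω : ℝ)) P := fun t => by
      simpa using hDmom 1 one_pos t
    exact (hD.not_isEquivalent_sublinear hint hk₁ hρ₀ hρ₁ hD₁).elim
  have hint := hDmom α hα₀
  have hint2 := hDmom (2 * α) (by positivity)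
  have htop := Skellam.tendsto_atTop_of_isEquivalent hk₁ hρ₀ hD₁
  have hmem := (Skellam.tcgfspI_moments hα₀ hα₁ hM₁ hM₂ hM hL hSY hD hint hint2 hSD).1
  obtain ⟨hvar, hpos, hcov⟩ := Skellam.tcgfspI_variance_covariance hk hlam hmu hα₀ hα₁ hM₁ hM₂ hM
    hL hSY hD hint hint2 hSD htop
  have hv : 0 < Skellam.gspVar k lam mu := Skellam.gspVar_pos hk hlam hmu
  have hc := hL.integral_firstPassage_one_pos
  have hb := hL.sq_integral_firstPassage_one_lt hα₁
  have hk₂' : 0 < k₂ := lt_of_lt_of_le (by positivity) hk₂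
  have hA := Skellam.tendsto_div_rpow_of_isEquivalent hk₁.ne' hD₁
  have hB := Skellam.tendsto_div_rpow_of_isEquivalent hk₂'.ne' hD₂
  have hne : Skellam.gspMean k lam mu ≠ 0 → ∃ K : ℝ, 0 < K ∧ Tendsto (fun t : ℝ≥0 =>
      Var[fun ω => (Skellam.tcgfspI α M₁ M₂ L D t ω : ℝ); P] / (t : ℝ) ^ (2 * ρ)) atTop
      (𝓝 K) := fun hm => by
    generalize Skellam.gspMean k lam mu = m at *
    generalize Skellam.gspVar k lam mu = v at *
    generalize ∫ ω, (Skellam.firstPassage L 1 ω : ℝ) ∂P = c at *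
    generalize ∫ ω, (Skellam.firstPassage L 1 ω : ℝ) ^ 2 ∂P = b at *
    -- The factor `0` is the limit of `t^(-ρ)`: after division by `t^(2ρ)`, the term linear in `E
    -- D(t)^α` disappears.
    refine ⟨v * c * (k₁ * 0) + m ^ 2 * (b * k₂ - c ^ 2 * k₁ ^ 2), ?_, ?_⟩
    · have h1 : c ^ 2 * k₁ ^ 2 < b * k₂ :=
        mul_lt_mul hb hk₂ (by positivity) ((sq_nonneg _).trans hb.le)
      have h2 := sub_pos.2 h1
      have h3 : 0 < m ^ 2 := by positivity
      rw [mul_zero, mul_zero, zero_add]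
      positivity
    · refine ((((hA.mul (Skellam.tendsto_nnreal_rpow_neg hρ₀)).const_mul (v * c)).add
        (((hB.const_mul b).sub ((hA.pow 2).const_mul (c ^ 2))).const_mul (m ^ 2)))).congr' ?_
      filter_upwards [eventually_gt_atTop 0] with t ht
      have ht' : (0 : ℝ) < t := ht
      have e : (t : ℝ) ^ (2 * ρ) = ((t : ℝ) ^ ρ) ^ 2 := by
        rw [mul_comm, Real.rpow_mul ht'.le]
        norm_num
      have hp : 0 < (t : ℝ) ^ ρ := by positivity
      rw [hvar, e, Real.rpow_neg ht'.le]
      field_simp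
  have hex : ∃ γ K : ℝ, 0 < γ ∧ γ < 1 ∧ 0 < K ∧ Tendsto (fun t : ℝ≥0 =>
      Var[fun ω => (Skellam.tcgfspI α M₁ M₂ L D t ω : ℝ); P] / (t : ℝ) ^ (2 * γ)) atTop
      (𝓝 K) := by
    by_cases hm : Skellam.gspMean k lam mu = 0
    -- With zero mean the variance is `v c E D(t)^α`, of order `t^ρ`, which forces `2γ = ρ`.
    · refine ⟨ρ / 2, Skellam.gspVar k lam mu * (∫ ω, (Skellam.firstPassage L 1 ω : ℝ) ∂P) * k₁,
        by positivity, by linarith, by positivity, ?_⟩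
      refine (hA.const_mul _).congr fun t => ?_
      rw [hvar, hm, mul_div_cancel₀ ρ two_ne_zero]
      ring
    · obtain ⟨K, hK, h⟩ := hne hm
      exact ⟨ρ, K, hρ₀, hρ₁, hK, h⟩
  obtain ⟨γ, K, hγ₀, hγ₁, hK, hlim⟩ := hex
  refine ⟨⟨hmem, Skellam.not_isWeaklyStationary_of_tendsto hmem hγ₀ hK hlim,
    γ, hγ₀, hγ₁, Skellam.corrDecay_of_tendsto hK hlim hpos hcov⟩, fun hm => ?_⟩
  obtain ⟨K', hK', h'⟩ := hne hm
  exact Skellam.corrDecay_of_tendsto hK' h' hpos hcov
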